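/- **Setting.** Consider the exosystem and plant $$\dot w = Sw,\qquad \dot x = AZ(x)+Bu+Pw,\qquad e = C_eZ(x)+Q_e w,\qquad Z(x)=\begin{bmatrix}x\\ Q(x)\end{bmatrix},$$ with $w\in\mathbb R^{n_w}$, $x\in\mathbb R^n$, $u\in\mathbb R^m$, $e\in\mathbb R^p$, and $Q:\mathbb R^n\to\mathbb R^{q-n}$ continuously differentiable. Let $D>0$ and assume that every solution of $\dot w=Sw$ (on $\mathbb R$) is bounded and $D$-periodic. The internal model is $\dot\eta=\Phi\eta+Ge$, where $\Phi=\mathrm{block.diag}(\phi,\dots,\phi)$ and $G=\mathrm{block.diag}(\Gamma,\dots,\Gamma)$ ($p$ blocks each), $\phi=\mathrm{block.diag}(0,\phi_1,\dots,\phi_\ell)$, $\phi_k=\begin{bmatrix}0&\omega_k\\-\omega_k&0\end{bmatrix}$, $\omega_k=k\frac{2\pi}{D}$, $\Gamma=\mathrm{col}(\gamma,N,\dots,N)$, with $\gamma\in\mathbb R\setminus\{0\}$, $N\in\mathbb R^2\setminus\{0\}$ and $\ell\ge 0$ oscillators; thus $\eta\in\mathbb R^{n_\eta}$ with $n_\eta=p(2\ell+1)$.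 Put $\mathcal Z(x,\eta)=\mathrm{col}(x,\eta,Q(x))$ and write the augmented system of plant and internal model as $$\begin{bmatrix}\dot x\\ \dot\eta\end{bmatrix}=\mathcal A\,\mathcal Z(x,\eta)+\mathcal B u+\mathcal P w .\tag{1}$$ **Data.** An experiment on (1), with some exosystem trajectory $w$, is sampled at times $0<t_0<\dots<t_{T-1}$, giving the matrices $U_0$, $\mathcal Z_0$, $\mathcal Z_1$ with columns $u(t_k)$, $\mathcal Z(x(t_k),\eta(t_k))$ and $(\dot x(t_k),\dot\eta(t_k))$ respectively. Let $\mathcal M\in\mathbb R^{d\times T}$, with $d$ the degree of the minimal polynomial of $S$, be the known matrix whose rows are the samples at $t_0,\dots,t_{T-1}$ of the functions $\frac{t^j}{j!}e^{\lambda t}$, $0\le j<k(\lambda)$, for each distinct real eigenvalue $\lambda$ of $S$, and of $\frac{t^j}{j!}e^{\mu t}\cos(\psi t)$, $\frac{t^j}{j!}e^{\mu t}\sin(\psi t)$, $0\le j<k(\lambda)$, for each distinct pair of complex conjugate eigenvalues $\lambda,\lambda^\star=\mu\pm i\psi$, $\psi>0$. Here $k(\lambda)$ is the order of the largest Jordan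 block of $S$ associated with $\lambda$, i.e. the multiplicity of $\lambda$ as a root of the minimal polynomial of $S$. **SDP.** Let $R_Q\in\mathbb R^{n\times r}$ satisfy $\frac{\partial Q}{\partial x}(x)^\top\frac{\partial Q}{\partial x}(x)\preceq R_QR_Q^\top$ for all $x\in\mathbb R^n$, put $\mathcal R_Q=\begin{bmatrix}R_Q\\0_{n_\eta\times r}\end{bmatrix}$, and let $\mathcal P_1=\mathcal P_1^\top\succ0$ of order $n+n_\eta$, $\mathcal Y_1\in\mathbb R^{T\times(n+n_\eta)}$, $\mathcal G_2\in\mathbb R^{T\times(q-n)}$ and $\alpha>0$ satisfy $$\mathcal Z_0\mathcal Y_1=\begin{bmatrix}\mathcal P_1\\0\end{bmatrix},\qquad \mathcal Z_0\mathcal G_2=\begin{bmatrix}0\\I_{q-n}\end{bmatrix},\qquad \mathcal M\begin{bmatrix}\mathcal Y_1&\mathcal G_2\end{bmatrix}=0,$$ $$\begin{bmatrix}\mathcal Z_1\mathcal Y_1+(\mathcal Z_1\mathcal Y_1)^\top+\alpha I&\mathcal Z_1\mathcal G_2&\mathcal P_1\mathcal R_Q\\(\mathcal Z_1\mathcal G_2)^\top&-I_{q-n}&0\\(\mathcal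 P_1\mathcal R_Q)^\top&0&-I_r\end{bmatrix}\preceq0 .$$ Let $\mathcal K=U_0\begin{bmatrix}\mathcal Y_1\mathcal P_1^{-1}&\mathcal G_2\end{bmatrix}$. **Theorem.** Let $w$ be any solution of $\dot w=Sw$ and consider the closed loop of (1), driven by $w$, with $u=\mathcal K\mathcal Z(x,\eta)$. Then 1. from every initial state $(x(0),\eta(0))$ there is a closed-loop solution defined for all $t\ge0$, and every such solution is bounded on $[0,\infty)$; 2. there is a bounded $D$-periodic continuously differentiable signal $e_*:\mathbb R\to\mathbb R^p$, depending on $w$ but not on $(x(0),\eta(0))$, and a rate $\kappa>0$, such that for every closed-loop solution there is a constant $c$ with $|e(t)-e_*(t)|\le c\,e^{-\kappa t}$ for all $t\ge0$; 3. with $\bar e_*=\sup_{t}|\dot e_*(t)|<\infty$ (Euclidean norm), $$\frac1D\int_0^D|e_*(t)|^2\,dt\le\frac{\bar e_*^2}{\left(\frac{2\pi}{D}\right)^2(\ell+1)^2}.$$ -/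

import Mathlib

open Matrix Set

namespace ApproxRegulation

/-- The controlled plant with exosystem
`w' = S w`, `x' = A Z(x) + B u + P w`, `e = Ce Z(x) + Qe w`, where `Z(x) = (x, Q(x))`.
Here `nQ = q - n` is the number of components of `Q`. -/
structure Plant (nw n m p nQ : ℕ) where
  S : Matrix (Fin nw) (Fin nw) ℝ
  A : Matrix (Fin n) (Fin n ⊕ Fin nQ) ℝ
  B : Matrix (Fin n) (Fin m) ℝ
  P : Matrix (Fin n) (Fin nw) ℝ
  Ce : Matrix (Fin p) (Fin n ⊕ Fin nQ) ℝ
  Qe : Matrix (Fin p) (Fin nw) ℝ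
  Q : (Fin n → ℝ) → (Fin nQ → ℝ)

/-! ### The exosystem -/

/-- `w` is a solution of `w' = S w` on the whole real line. -/
def IsExosystemSolution {nw : ℕ} (S : Matrix (Fin nw) (Fin nw) ℝ) (w : ℝ → Fin nw → ℝ) : Prop :=
  ∀ t : ℝ, HasDerivAt w (S *ᵥ w t) t

/-- Every solution of the exosystem is bounded and `D`-periodic. -/
def ExosystemPeriodic {nw : ℕ} (S : Matrix (Fin nw) (Fin nw) ℝ) (D : ℝ) : Prop :=
  ∀ w : ℝ → Fin nw → ℝ, IsExosystemSolution S w →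
    Bornology.IsBounded (range w) ∧ Function.Periodic w D

/-! ### The internal model -/

/-- Index set of the state of one copy of the internal model: one integrator and `ℓ` oscillators of
dimension two, so `2 ℓ + 1` elements. -/
abbrev OscIdx (ℓ : ℕ) : Type := Unit ⊕ (Fin 2 × Fin ℓ)

/-- Index set of `η`: `p` copies, so `p (2 ℓ + 1)` elements. -/
abbrev EtaIdx (ℓ p : ℕ) : Type := OscIdx ℓ × Fin p

/-- The oscillator block with frequency `ω`. -/
def oscBlock (ω : ℝ) : Matrix (Fin 2) (Fin 2) ℝ := !![0, ω; -ω, 0]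

/-- `φ = block.diag (0, φ_1, …, φ_ℓ)` with frequencies `ω_k = k (2 π / D)`, `k = 1, …, ℓ`. -/
noncomputable def phi (ℓ : ℕ) (D : ℝ) : Matrix (OscIdx ℓ) (OscIdx ℓ) ℝ :=
  Matrix.fromBlocks 0 0 0
    (Matrix.blockDiagonal fun k : Fin ℓ => oscBlock (((k : ℕ) + 1 : ℝ) * (2 * Real.pi / D)))

/-- `Γ = col (γ, N, …, N)`. -/
def Gam (ℓ : ℕ) (γ : ℝ) (N : Fin 2 → ℝ) : OscIdx ℓ → ℝ :=
  Sum.elim (fun _ => γ) (fun i => N i.1)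

/-- `Φ = block.diag (φ, …, φ)`, with `p` blocks. -/
noncomputable def bigPhi (ℓ p : ℕ) (D : ℝ) : Matrix (EtaIdx ℓ p) (EtaIdx ℓ p) ℝ :=
  Matrix.blockDiagonal fun _ : Fin p => phi ℓ D

/-- `G = block.diag (Γ, …, Γ)`, with `p` blocks. -/
def bigG (ℓ p : ℕ) (γ : ℝ) (N : Fin 2 → ℝ) : Matrix (EtaIdx ℓ p) (Fin p) ℝ :=
  Matrix.of fun i k => if i.2 = k then Gam ℓ γ N i.1 else 0

/-! ### The augmented system -/

/-- Index set of the augmented state `(x, η)`. -/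
abbrev StIdx (n ℓ p : ℕ) : Type := Fin n ⊕ EtaIdx ℓ p

section

variable {nw n m p nQ : ℕ}

/-- The regulation error `e = Ce Z(x) + Qe w`. -/
def Plant.err (pl : Plant nw n m p nQ) (x : Fin n → ℝ) (w : Fin nw → ℝ) : Fin p → ℝ :=
  pl.Ce *ᵥ Sum.elim x (pl.Q x) + pl.Qe *ᵥ w

/-- The stacked vector `𝒵(x, η) = (x, η, Q(x))`, where `z = (x, η)`. -/
def Plant.calZ (pl : Plant nw n m p nQ) (ℓ : ℕ) (z : StIdx n ℓ p → ℝ) :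
    StIdx n ℓ p ⊕ Fin nQ → ℝ :=
  Sum.elim z (pl.Q fun i => z (Sum.inl i))

/-- `𝒜 = [Ā, 0, Â; G C̄e, Φ, G Ĉe]`. -/
noncomputable def Plant.calA (pl : Plant nw n m p nQ) (ℓ : ℕ) (D γ : ℝ) (N : Fin 2 → ℝ) :
    Matrix (StIdx n ℓ p) (StIdx n ℓ p ⊕ Fin nQ) ℝ :=
  Matrix.fromCols
    (Matrix.fromBlocks pl.A.toCols₁ 0 (bigG ℓ p γ N * pl.Ce.toCols₁) (bigPhi ℓ p D))
    (Matrix.fromRows pl.A.toCols₂ (bigG ℓ p γ N * pl.Ce.toCols₂))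

/-- `ℬ = [B; 0]`. -/
def Plant.calB (pl : Plant nw n m p nQ) (ℓ : ℕ) : Matrix (StIdx n ℓ p) (Fin m) ℝ :=
  Matrix.fromRows pl.B 0

/-- `𝒫 = [P; G Qe]`. -/
def Plant.calP (pl : Plant nw n m p nQ) (ℓ : ℕ) (γ : ℝ) (N : Fin 2 → ℝ) :
    Matrix (StIdx n ℓ p) (Fin nw) ℝ :=
  Matrix.fromRows pl.P (bigG ℓ p γ N * pl.Qe)

/-- Right-hand side `𝒜 𝒵(z) + ℬ u + 𝒫 w` of the augmented system. -/
noncomputable def Plant.augRHS (pl : Plant nw n m p nQ) (ℓ : ℕ) (D γ : ℝ) (N : Fin 2 → ℝ)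
    (z : StIdx n ℓ p → ℝ) (u : Fin m → ℝ) (w : Fin nw → ℝ) : StIdx n ℓ p → ℝ :=
  pl.calA ℓ D γ N *ᵥ pl.calZ ℓ z + pl.calB ℓ *ᵥ u + pl.calP ℓ γ N *ᵥ w

/-- `z = (x, η)` is a solution, for all `t ≥ 0`, of the augmented system driven by `w` under the
control law `u = K 𝒵(x, η)`. -/
def Plant.IsClosedLoopSolution (pl : Plant nw n m p nQ) (ℓ : ℕ) (D γ : ℝ) (N : Fin 2 → ℝ)
    (K : Matrix (Fin m) (StIdx n ℓ p ⊕ Fin nQ) ℝ) (w : ℝ → Fin nw → ℝ)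
    (z : ℝ → StIdx n ℓ p → ℝ) : Prop :=
  ∀ t : ℝ, 0 ≤ t →
    HasDerivWithinAt z (pl.augRHS ℓ D γ N (z t) (K *ᵥ pl.calZ ℓ (z t)) (w t)) (Ici 0) t

/-! ### The dataset -/

/-- An experiment on the augmented system, with exosystem trajectory `w`, input `u` and state
`z = (x, η)`, sampled at the times `0 < t_0 < … < t_{T-1}`. The state equation is asked for at the
sampling times only, and with right derivatives, so that inputs that jump (for example piecewise
constant ones) are allowed. -/
structure Plant.IsExperiment (pl : Plant nw n m p nQ) (ℓ : ℕ) (D γ : ℝ) (N : Fin 2 → ℝ)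
    {T : ℕ} (τ : Fin T → ℝ) (w : ℝ → Fin nw → ℝ) (u : ℝ → Fin m → ℝ)
    (z : ℝ → StIdx n ℓ p → ℝ) : Prop where
  times_pos : ∀ k, 0 < τ k
  times_lt : StrictMono τ
  exo : IsExosystemSolution pl.S w
  state : ∀ k, HasDerivWithinAt z (pl.augRHS ℓ D γ N (z (τ k)) (u (τ k)) (w (τ k)))
    (Ici (τ k)) (τ k)

/-- `U_0 = [u(t_0) … u(t_{T-1})]`. -/
def dataU {T : ℕ} (τ : Fin T → ℝ) (u : ℝ → Fin m → ℝ) : Matrix (Fin m) (Fin T) ℝ :=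
  Matrix.of fun i k => u (τ k) i

/-- `𝒵_0 = [𝒵(x(t_0), η(t_0)) … 𝒵(x(t_{T-1}), η(t_{T-1}))]`. -/
def Plant.dataZ (pl : Plant nw n m p nQ) (ℓ : ℕ) {T : ℕ} (τ : Fin T → ℝ)
    (z : ℝ → StIdx n ℓ p → ℝ) : Matrix (StIdx n ℓ p ⊕ Fin nQ) (Fin T) ℝ :=
  Matrix.of fun i k => pl.calZ ℓ (z (τ k)) i

/-- `𝒵_1`, whose columns are the samples of the derivative of `(x, η)`. -/
noncomputable def dataDeriv {ℓ : ℕ} {T : ℕ} (τ : Fin T → ℝ)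
    (z : ℝ → StIdx n ℓ p → ℝ) : Matrix (StIdx n ℓ p) (Fin T) ℝ :=
  Matrix.of fun i k => derivWithin z (Ici (τ k)) (τ k) i

end

/-! ### The matrix of modes of the exosystem -/

/-- The order of the largest Jordan block of `S` associated with `lam`, that is, the multiplicity of
`lam` as a root of the minimal polynomial of `S` (zero if `lam` is not an eigenvalue). -/
noncomputable def maxJordanOrder {nw : ℕ} (S : Matrix (Fin nw) (Fin nw) ℝ) (lam : ℂ) : ℕ :=
  ((minpoly ℝ S).map (algebraMap ℝ ℂ)).rootMultiplicity lam

/-- Row indices of `ℳ`. For each real eigenvalue `lam` there is one row `(lam, j, false)` for each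
`j < maxJordanOrder S lam`; for each pair of complex conjugate eigenvalues, represented by the one
with positive imaginary part, there is a cosine row `(lam, j, false)` and a sine row
`(lam, j, true)` for each such `j`. The number of rows is the degree of the minimal polynomial. -/
def ModeIdx {nw : ℕ} (S : Matrix (Fin nw) (Fin nw) ℝ) : Type :=
  {r : ℂ × ℕ × Bool //
    r.2.1 < maxJordanOrder S r.1 ∧ 0 ≤ r.1.im ∧ (r.2.2 = true → 0 < r.1.im)}

/-- `ℳ`: the row with index `(μ + i ψ, j, b)` samples the function `t ^ j / j! * exp (μ t)`
multiplied by `cos (ψ t)` (if `b = false`) or `sin (ψ t)` (if `b = true`). -/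
noncomputable def modeMatrix {nw : ℕ} (S : Matrix (Fin nw) (Fin nw) ℝ) {T : ℕ} (τ : Fin T → ℝ) :
    Matrix (ModeIdx S) (Fin T) ℝ :=
  Matrix.of fun r k =>
    (τ k) ^ r.1.2.1 / (Nat.factorial r.1.2.1 : ℝ) * Real.exp (r.1.1.re * τ k) *
      (if r.1.2.2 = true then Real.sin (r.1.1.im * τ k) else Real.cos (r.1.1.im * τ k))

/-! ### The semidefinite program -/

/-- The Jacobian matrix of `Q` at `x`. -/
noncomputable def jacobian {n nQ : ℕ} (Q : (Fin n → ℝ) → (Fin nQ → ℝ)) (x : Fin n → ℝ) :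
    Matrix (Fin nQ) (Fin n) ℝ :=
  LinearMap.toMatrix' (fderiv ℝ Q x : (Fin n → ℝ) →ₗ[ℝ] (Fin nQ → ℝ))

/-- `(∂Q/∂x)ᵀ (∂Q/∂x) ⪯ R_Q R_Qᵀ` everywhere. -/
def JacobianBound {n nQ r : ℕ} (Q : (Fin n → ℝ) → (Fin nQ → ℝ)) (RQ : Matrix (Fin n) (Fin r) ℝ) :
    Prop :=
  ∀ x : Fin n → ℝ, (RQ * RQᵀ - (jacobian Q x)ᵀ * jacobian Q x).PosSemidef

/-- `ℛ_Q = [R_Q; 0]`. -/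
def calR {n r : ℕ} (ℓ p : ℕ) (RQ : Matrix (Fin n) (Fin r) ℝ) :
    Matrix (StIdx n ℓ p) (Fin r) ℝ :=
  Matrix.fromRows RQ 0

/-- The block matrix of the linear matrix inequality. -/
def lmiMatrix {n ℓ p nQ r T : ℕ} (Z1 : Matrix (StIdx n ℓ p) (Fin T) ℝ)
    (RQ : Matrix (Fin n) (Fin r) ℝ) (P1 : Matrix (StIdx n ℓ p) (StIdx n ℓ p) ℝ)
    (Y1 : Matrix (Fin T) (StIdx n ℓ p) ℝ) (G2 : Matrix (Fin T) (Fin nQ) ℝ) (α : ℝ) :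
    Matrix ((StIdx n ℓ p ⊕ Fin nQ) ⊕ Fin r) ((StIdx n ℓ p ⊕ Fin nQ) ⊕ Fin r) ℝ :=
  Matrix.fromBlocks
    (Matrix.fromBlocks (Z1 * Y1 + (Z1 * Y1)ᵀ + α • 1) (Z1 * G2) (Z1 * G2)ᵀ (-1))
    (Matrix.fromRows (P1 * calR ℓ p RQ) 0)
    (Matrix.fromCols (P1 * calR ℓ p RQ)ᵀ 0)
    (-1)

/-- `(P1, Y1, G2, α)` is a feasible point of the semidefinite program with data `Z0`, `Z1`, `ℳ`
and `R_Q`. -/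
structure SDPFeasible {n ℓ p nQ r T : ℕ} {ι : Type} (Z0 : Matrix (StIdx n ℓ p ⊕ Fin nQ) (Fin T) ℝ)
    (Z1 : Matrix (StIdx n ℓ p) (Fin T) ℝ) (M : Matrix ι (Fin T) ℝ)
    (RQ : Matrix (Fin n) (Fin r) ℝ) (P1 : Matrix (StIdx n ℓ p) (StIdx n ℓ p) ℝ)
    (Y1 : Matrix (Fin T) (StIdx n ℓ p) ℝ) (G2 : Matrix (Fin T) (Fin nQ) ℝ) (α : ℝ) : Prop where
  posDef : P1.PosDef
  alpha_pos : 0 < α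
  Z0_Y1 : Z0 * Y1 = Matrix.fromRows P1 0
  lmi : (-lmiMatrix Z1 RQ P1 Y1 G2 α).PosSemidef
  Z0_G2 : Z0 * G2 = Matrix.fromRows 0 1
  modes : M * Matrix.fromCols Y1 G2 = 0

/-- The controller gain `𝒦 = U_0 [Y1 P1⁻¹, G2]`. -/
noncomputable def gain {n ℓ p nQ m T : ℕ} (U0 : Matrix (Fin m) (Fin T) ℝ)
    (P1 : Matrix (StIdx n ℓ p) (StIdx n ℓ p) ℝ) (Y1 : Matrix (Fin T) (StIdx n ℓ p) ℝ)
    (G2 : Matrix (Fin T) (Fin nQ) ℝ) : Matrix (Fin m) (StIdx n ℓ p ⊕ Fin nQ) ℝ :=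
  U0 * Matrix.fromCols (Y1 * P1⁻¹) G2

end ApproxRegulation

open ApproxRegulation

/-!
The closed loop is a contraction, so it has a periodic steady state that attracts every solution;
the internal model then forces the low harmonics of the steady-state error to vanish, and a
Wirtinger inequality bounds what is left.

*The data replace the model.* Let `𝒲₀` collect the (unmeasured) samples of the exosystem state. The
exosystem is periodic, so the Fourier coefficients of its trajectories are eigenvectors of `S` for
eigenvalues `2 π i k / D`, or zero; a trajectory is thus a finite sum of modes and the rows of `𝒲₀`
lie in the row space of `ℳ` (`IsExosystemSolution.sum_mul_eq_zero`). Hence `𝒲₀ [Y1 P1⁻¹, G2] = 0`,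
and together with `𝒵₀ [Y1 P1⁻¹, G2] = 1` the data equation gives
`𝒜 + ℬ 𝒦 = 𝒵₁ [Y1 P1⁻¹, G2]` (`closedLoop_matrix_eq_data`).

*Contraction.* The Jacobian bound integrates to `|Q x - Q y| ≤ |R_Qᵀ (x - y)|`
(`JacobianBound.increment_le`). Testing the linear matrix inequality on the difference of two states
and the matching increment of `Q` shows that `δᵀ P1⁻¹ δ` decays exponentially along the difference
`δ` of two solutions (`lmi_increment`, `exists_exp_contraction`). The closed loop is globally
Lipschitz, so its solutions are global (`exists_solution_of_exosystem`); the values at multiples of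
`D` of any solution form a Cauchy sequence whose limit starts a periodic solution
(`exists_periodic_solution`). The signal `e_*` is the error along that solution.

*Harmonics.* Along the periodic solution, the states of the internal model are periodic responses
of an integrator and of oscillators at the frequencies `2 π k / D`, `k ≤ ℓ`, driven by `e_*`. A
resonant system has a periodic response only if its input has no component at the resonance
frequency, so the Fourier coefficients of `e_*` of order up to `ℓ` vanish
(`Plant.fourierCoeffOn_err_eq_zero`). Parseval's identity for `e_*` and its derivative then yields
the factor `(2 π / D)² (ℓ + 1)²` (`exists_isLUB_and_meanSquare_le`).
-/

/-! ### Fourier coefficients of periodic functions -/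

section Fourier

open MeasureTheory

/-- Integration by parts over a period, the coefficient of order zero included. -/
theorem fourierCoeffOn_deriv_of_eq {D : ℝ} (hD : 0 < D) {f f' : ℝ → ℂ}
    (hf : ∀ t, HasDerivAt f (f' t) t) (hf' : Continuous f') (hper : f D = f 0) (n : ℤ) :
    fourierCoeffOn hD f' n = (2 * Real.pi * Complex.I * n / D) * fourierCoeffOn hD f n := by
  have hD' : (D : ℂ) ≠ 0 := by exact_mod_cast hD.ne'
  rcases eq_or_ne n 0 with rfl | hn
  · have h := intervalIntegral.integral_eq_sub_of_hasDerivAt (a := 0) (b := D)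
      (fun t _ => hf t) (hf'.intervalIntegrable _ _)
    rw [hper, sub_self] at h
    simp [fourierCoeffOn_eq_integral, h]
  · have hn' : (n : ℂ) ≠ 0 := by exact_mod_cast hn
    have hpi : (Real.pi : ℂ) ≠ 0 := by exact_mod_cast Real.pi_ne_zero
    rw [fourierCoeffOn_of_hasDerivAt hD hn (fun t _ => hf t) (hf'.intervalIntegrable _ _), hper]
    simp only [sub_self, mul_zero, zero_sub, Complex.ofReal_zero, sub_zero]
    field_simp [Complex.I_ne_zero]

/-- A Wirtinger inequality: differentiation multiplies the coefficient of order `n` by `2 π i n / D`,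
so by Parseval it enlarges a signal without harmonics of order up to `l` at least by the factor
`(2 π / D) (l + 1)`. -/
theorem wirtinger_of_fourierCoeffOn_eq_zero {D : ℝ} (hD : 0 < D) {f f' : ℝ → ℂ}
    (hf : ∀ t, HasDerivAt f (f' t) t) (hf' : Continuous f') (hper : f D = f 0) (l : ℕ)
    (hl : ∀ n : ℤ, n.natAbs ≤ l → fourierCoeffOn hD f n = 0) :
    ((2 * Real.pi / D) * (l + 1)) ^ 2 * ∫ t in (0 : ℝ)..D, ‖f t‖ ^ 2 ≤
      ∫ t in (0 : ℝ)..D, ‖f' t‖ ^ 2 := by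
  have hmem : ∀ g : ℝ → ℂ, Continuous g → MemLp g 2 (volume.restrict (Ioc 0 D)) := by
    intro g hg
    obtain ⟨C, hC⟩ := isCompact_Icc.exists_bound_of_continuousOn (hg.continuousOn (s := Icc 0 D))
    exact MemLp.of_bound hg.aestronglyMeasurable C
      ((ae_restrict_mem measurableSet_Ioc).mono fun t ht => hC t (Ioc_subset_Icc_self ht))
  have hfc : Continuous f := continuous_iff_continuousAt.2 fun t => (hf t).continuousAt
  have h1 := (hasSum_sq_fourierCoeffOn hD (hmem f hfc)).mul_left (((2 * Real.pi / D) * (l + 1)) ^ 2)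
  have h2 := hasSum_sq_fourierCoeffOn hD (hmem f' hf')
  have key := hasSum_le (fun n => ?_) h1 h2
  · simp only [sub_zero, smul_eq_mul] at key
    have : 0 < D⁻¹ := inv_pos.2 hD
    rw [mul_left_comm] at key
    exact le_of_mul_le_mul_left key this
  · rw [fourierCoeffOn_deriv_of_eq hD hf hf' hper, norm_mul]
    refine le_of_le_of_eq ?_ (mul_pow _ _ 2).symm
    by_cases hn : n.natAbs ≤ l
    · simp [hl n hn]
    · have h3 : ((l : ℝ) + 1) ≤ |(n : ℝ)| := by
        have : l + 1 ≤ n.natAbs := by omega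
        have h4 : ((l + 1 : ℕ) : ℝ) ≤ (n.natAbs : ℝ) := by exact_mod_cast this
        rw [Nat.cast_natAbs] at h4
        push_cast at h4
        exact h4
      have h5 : ‖(2 * Real.pi * Complex.I * n / D : ℂ)‖ = (2 * Real.pi / D) * |(n : ℝ)| := by
        simp [abs_of_pos Real.pi_pos, abs_of_pos hD]
        ring
      rw [h5]
      exact mul_le_mul_of_nonneg_right (pow_le_pow_left₀ (by positivity)
        (mul_le_mul_of_nonneg_left h3 (by positivity)) 2) (by positivity)

end Fourier

/-! ### Periodic exosystems as finite sums of modes -/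

section Modes

open MeasureTheory

theorem fourierCoeffOn_sum_const_mul {ι : Type*} [Fintype ι] {D : ℝ} (hD : 0 < D) (a : ι → ℂ)
    {f : ι → ℝ → ℂ} (hf : ∀ i, Continuous (f i)) (n : ℤ) :
    fourierCoeffOn hD (fun t => ∑ i, a i * f i t) n = ∑ i, a i * fourierCoeffOn hD (f i) n := by
  simp only [fourierCoeffOn_eq_integral, sub_zero, fourier_coe_apply, smul_eq_mul, Finset.mul_sum]
  rw [intervalIntegral.integral_finsetSum, Finset.smul_sum]
  · refine Finset.sum_congr rfl fun i _ => ?_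
    have e : ∀ x : ℂ, a i * (1 / D) • x = (1 / D) • (a i * x) := fun x => mul_smul_comm _ _ _
    rw [e, ← intervalIntegral.integral_const_mul]
    congr 2
    ext t
    ring
  · intro i _
    apply Continuous.intervalIntegrable
    have := hf i
    fun_prop

theorem fourierCoeff_eq_fourierCoeffOn {D : ℝ} (hD : 0 < D) [Fact (0 < D)]
    (f : AddCircle D → ℂ) (n : ℤ) :
    fourierCoeff f n = fourierCoeffOn hD (fun t : ℝ => f t) n := by
  rw [fourierCoeff_eq_intervalIntegral _ _ 0, fourierCoeffOn_eq_integral]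
  simp only [fourier_coe_apply, sub_zero, zero_add]

/-- A continuous periodic function is the sum of its Fourier series as soon as only finitely many
Fourier coefficients do not vanish. -/
theorem Function.Periodic.hasSum_fourierCoeffOn {D : ℝ} (hD : 0 < D) {g : ℝ → ℂ}
    (hg : Continuous g) (hper : Function.Periodic g D)
    (hfin : {n : ℤ | fourierCoeffOn hD g n ≠ 0}.Finite) (t : ℝ) :
    HasSum (fun n : ℤ => fourierCoeffOn hD g n *
      Complex.exp (2 * Real.pi * Complex.I * n * t / D)) (g t) := by
  have : Fact (0 < D) := ⟨hD⟩
  let f : C(AddCircle D, ℂ) := ⟨hper.lift, by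
    exact continuous_coinduced_dom.mpr hg⟩
  have hc : ∀ n, fourierCoeff f n = fourierCoeffOn hD g n := fun n =>
    fourierCoeff_eq_fourierCoeffOn hD f n
  have hs : Summable (fourierCoeff f) := by
    refine summable_of_hasFiniteSupport ?_
    simpa only [Function.HasFiniteSupport, Function.support, hc] using hfin
  have h := has_pointwise_sum_fourier_series_of_summable hs (t : AddCircle D)
  simp only [hc, fourier_coe_apply, smul_eq_mul] at h
  exact h

theorem Matrix.isRoot_minpoly_map_of_mulVec_eq_smul {n : Type*} [Fintype n] [DecidableEq n]
    {S : Matrix n n ℝ} {c : n → ℂ} {lam : ℂ} (hc : c ≠ 0)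
    (h : S.map (algebraMap ℝ ℂ) *ᵥ c = lam • c) :
    ((minpoly ℝ S).map (algebraMap ℝ ℂ)).IsRoot lam := by
  have hev : Module.End.HasEigenvector (Matrix.toLin' (S.map (algebraMap ℝ ℂ))) lam c :=
    ⟨Module.End.mem_eigenspace_iff.2 (by simpa using h), hc⟩
  have h1 := Module.End.aeval_apply_of_hasEigenvector (p := (minpoly ℝ S).map (algebraMap ℝ ℂ)) hev
  have h2 : Polynomial.aeval (Matrix.toLin' (S.map (algebraMap ℝ ℂ)))
      ((minpoly ℝ S).map (algebraMap ℝ ℂ)) = 0 := by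
    have h3 : Polynomial.aeval (S.map (algebraMap ℝ ℂ)) (minpoly ℝ S) = 0 := by
      have := Polynomial.aeval_algHom_apply (Algebra.ofId ℝ ℂ).mapMatrix S (minpoly ℝ S)
      rw [minpoly.aeval, map_zero] at this
      exact this
    rw [Polynomial.aeval_map_algebraMap]
    have := Polynomial.aeval_algHom_apply
      ((Matrix.toLinAlgEquiv' (R := ℂ) (n := n)).toAlgHom.restrictScalars ℝ)
      (S.map (algebraMap ℝ ℂ)) (minpoly ℝ S)
    rw [h3, map_zero] at this
    exact this
  rw [h2, LinearMap.zero_apply, eq_comm, smul_eq_zero] at h1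
  exact h1.resolve_right hc

/-- A vector that the mode matrix annihilates also annihilates the samples of the exponentials of
the imaginary eigenvalues. -/
theorem sum_exp_mul_eq_zero_of_modeMatrix {nw T : ℕ} {S : Matrix (Fin nw) (Fin nw) ℝ}
    {τ : Fin T → ℝ} {v : Fin T → ℝ} (hv : modeMatrix S τ *ᵥ v = 0) {ω : ℝ}
    (hroot : ((minpoly ℝ S).map (algebraMap ℝ ℂ)).IsRoot (ω * Complex.I)) :
    ∑ k, Complex.exp (ω * Complex.I * τ k) * (v k : ℂ) = 0 := by
  -- Rows are indexed by the eigenvalue with nonnegative imaginary part.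
  have hroot' : ((minpoly ℝ S).map (algebraMap ℝ ℂ)).IsRoot (⟨0, |ω|⟩ : ℂ) := by
    rcases abs_choice ω with h | h
    · convert hroot using 1
      apply Complex.ext <;> simp [h]
    · have h1 : (⟨0, |ω|⟩ : ℂ) = (starRingEnd ℂ) (ω * Complex.I) := by
        apply Complex.ext <;> simp [h]
      rw [Polynomial.IsRoot, Polynomial.eval_map_algebraMap] at hroot ⊢
      rw [h1, Polynomial.aeval_conj, hroot, map_zero]
  have hpos : 0 < maxJordanOrder S ⟨0, |ω|⟩ := by
    refine (Polynomial.rootMultiplicity_pos ?_).2 hroot'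
    exact (((minpoly.monic (Matrix.isIntegral S)).map _).ne_zero)
  have hrow : ∀ b : Bool, (b = true → 0 < |ω|) →
      ∑ k, (if b = true then Real.sin (|ω| * τ k) else Real.cos (|ω| * τ k)) * v k = 0 := by
    intro b hb
    have h := congrFun hv ⟨((⟨0, |ω|⟩ : ℂ), 0, b), hpos, abs_nonneg ω, hb⟩
    refine Eq.trans ?_ h
    refine Finset.sum_congr rfl fun k _ => congrArg (· * v k) ?_
    change _ = (τ k) ^ 0 / (Nat.factorial 0 : ℝ) * Real.exp (0 * τ k) *
      (if b = true then Real.sin (|ω| * τ k) else Real.cos (|ω| * τ k))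
    simp
  have hcos : ∑ k, Real.cos (ω * τ k) * v k = 0 := by
    have h := hrow false (by simp)
    rcases abs_choice ω with h' | h' <;> simpa [h'] using h
  have hsin : ∑ k, Real.sin (ω * τ k) * v k = 0 := by
    rcases eq_or_ne ω 0 with rfl | hω
    · simp
    · have h := hrow true fun _ => abs_pos.2 hω
      rcases abs_choice ω with h' | h' <;> simpa [h'] using h
  have h : ∀ k, Complex.exp (ω * Complex.I * τ k) * (v k : ℂ) =
      ((Real.cos (ω * τ k) * v k : ℝ) : ℂ) + ((Real.sin (ω * τ k) * v k : ℝ) : ℂ) * Complex.I := by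
    intro k
    rw [mul_right_comm, Complex.exp_mul_I]
    push_cast
    ring
  simp_rw [h]
  rw [Finset.sum_add_distrib, ← Finset.sum_mul, ← Complex.ofReal_sum, ← Complex.ofReal_sum, hcos,
    hsin]
  simp

/-- The samples of an exosystem trajectory are combinations of the rows of the mode matrix.
Since the trajectory is periodic, its Fourier coefficient at frequency `2 π n / D` is either zero or
an eigenvector of `S` for `2 π i n / D`, so its Fourier series is a finite sum of modes. -/
theorem ApproxRegulation.IsExosystemSolution.sum_mul_eq_zero {nw T : ℕ}
    {S : Matrix (Fin nw) (Fin nw) ℝ} {D : ℝ} (hD : 0 < D) {w : ℝ → Fin nw → ℝ}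
    (hw : IsExosystemSolution S w) (hper : Function.Periodic w D) {τ : Fin T → ℝ} {v : Fin T → ℝ}
    (hv : modeMatrix S τ *ᵥ v = 0) (i : Fin nw) : ∑ k, w (τ k) i * v k = 0 := by
  have hwc : Continuous w := continuous_iff_continuousAt.2 fun t => (hw t).continuousAt
  have hcont : ∀ j, Continuous fun t => (w t j : ℂ) := fun j =>
    Complex.continuous_ofReal.comp ((continuous_apply j).comp hwc)
  set c : ℤ → Fin nw → ℂ := fun n j => fourierCoeffOn hD (fun t => (w t j : ℂ)) n with hc
  have heig : ∀ n : ℤ, S.map (algebraMap ℝ ℂ) *ᵥ c n =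
      (2 * Real.pi * Complex.I * n / D : ℂ) • c n := by
    intro n
    ext j
    have hd : ∀ t, HasDerivAt (fun t => (w t j : ℂ)) (∑ k, (S j k : ℂ) * (w t k : ℂ)) t := by
      intro t
      have h := ((hasDerivAt_pi.1 (hw t)) j).ofReal_comp
      simpa [Matrix.mulVec, dotProduct] using h
    have h1 := fourierCoeffOn_deriv_of_eq hD hd
      (continuous_finsetSum _ fun k _ => continuous_const.mul (hcont k))
      (by have := hper 0; rw [zero_add] at this; simp [this]) n
    rw [fourierCoeffOn_sum_const_mul hD _ hcont] at h1
    simpa [Matrix.mulVec, dotProduct, hc] using h1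
  have hroot : ∀ n : ℤ, c n ≠ 0 → ((minpoly ℝ S).map (algebraMap ℝ ℂ)).IsRoot
      ((2 * Real.pi * n / D : ℝ) * Complex.I) := by
    intro n hn
    convert Matrix.isRoot_minpoly_map_of_mulVec_eq_smul hn (heig n) using 1
    push_cast
    ring
  have hfin : {n : ℤ | c n ≠ 0}.Finite := by
    have hne : ((minpoly ℝ S).map (algebraMap ℝ ℂ)) ≠ 0 :=
      ((minpoly.monic (Matrix.isIntegral S)).map _).ne_zero
    refine Set.Finite.of_injOn (f := fun n : ℤ => ((2 * Real.pi * n / D : ℝ) * Complex.I : ℂ))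
      (fun n hn => hroot n hn) ?_ (Polynomial.finite_setOfPred_isRoot hne)
    intro n _ m _ h
    have h1 := mul_right_cancel₀ Complex.I_ne_zero h
    have h2 : 2 * Real.pi * n / D = 2 * Real.pi * m / D := by exact_mod_cast h1
    have hpi := Real.pi_ne_zero
    field_simp at h2
    exact_mod_cast h2
  have hsum : ∀ k, HasSum (fun n : ℤ => c n i *
      Complex.exp (2 * Real.pi * Complex.I * n * τ k / D) * (v k : ℂ))
      ((w (τ k) i : ℂ) * (v k : ℂ)) := by
    intro k
    refine (Function.Periodic.hasSum_fourierCoeffOn hD (hcont i) ?_ ?_ (τ k)).mul_right _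
    · intro t
      simp [hper t]
    · exact hfin.subset fun n hn h => hn (congrFun h i)
  have htot := hasSum_sum (s := Finset.univ) fun k _ => hsum k
  have hzero : ∀ n : ℤ, ∑ k, c n i *
      Complex.exp (2 * Real.pi * Complex.I * n * τ k / D) * (v k : ℂ) = 0 := by
    intro n
    by_cases hn : c n = 0
    · simp [hn]
    · have h := sum_exp_mul_eq_zero_of_modeMatrix hv (hroot n hn)
      have e : ∀ k, (2 * Real.pi * Complex.I * n * τ k / D : ℂ) =
          ((2 * Real.pi * n / D : ℝ) : ℂ) * Complex.I * τ k := by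
        intro k; push_cast; ring
      simp_rw [e, mul_assoc (c n i), ← Finset.mul_sum, h, mul_zero]
  simp_rw [hzero] at htot
  have := htot.unique hasSum_zero
  exact_mod_cast this

end Modes

/-! ### Global solutions and periodic solutions of Lipschitz differential equations -/

section ODE

open Filter Topology
open scoped NNReal Manifold

variable {E : Type*} [NormedAddCommGroup E] [NormedSpace ℝ E] [CompleteSpace E]

/-- Around every initial value, the time for which the Picard–Lindelöf theorem provides a solution
depends on the Lipschitz constant only, not on the initial value. -/
theorem LipschitzWith.exists_hasDerivAt_Ioo {v : E → E} {K : ℝ≥0} (hv : LipschitzWith K v)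
    (x : E) : ∃ γ : ℝ → E, γ 0 = x ∧ ∀ t ∈ Ioo (-(1 / (2 * (K + 1)) : ℝ)) (1 / (2 * (K + 1))),
      HasDerivAt γ (v (γ t)) t := by
  set ε : ℝ := 1 / (2 * (K + 1)) with hε
  have hK : (0 : ℝ) ≤ K := K.2
  have hε0 : 0 < ε := by positivity
  -- On the ball of radius `‖v x‖ + 1`, the field is bounded by `(K + 1)` times that radius;
  -- twice this bound, over the time `ε`, is exactly the radius.
  let a : ℝ≥0 := ‖v x‖₊ + 1
  let L : ℝ≥0 := 2 * (K + 1) * a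
  have hpl : IsPicardLindelof (fun _ => v) (tmin := -ε) (tmax := ε)
      ⟨0, by constructor <;> linarith⟩ x a 0 L K := by
    refine .of_time_independent (fun y hy => ?_) hv.lipschitzOnWith ?_
    · have h1 : ‖v y - v x‖ ≤ K * ‖y - x‖ := hv.norm_sub_le y x
      have h2 : ‖y - x‖ ≤ a := mem_closedBall_iff_norm.1 hy
      have h3 : ‖v y‖ ≤ ‖v y - v x‖ + ‖v x‖ := norm_le_norm_sub_add _ _
      have h4 : (K : ℝ) * ‖y - x‖ ≤ K * a := mul_le_mul_of_nonneg_left h2 hK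
      have h5 : ((a : ℝ≥0) : ℝ) = ‖v x‖ + 1 := by simp [a]
      have h6 : ((L : ℝ≥0) : ℝ) = 2 * (K + 1) * a := by simp [L]
      have h7 : (0 : ℝ) ≤ K * a := by positivity
      rw [h6]
      nlinarith [norm_nonneg (v x)]
    · have h6 : ((L : ℝ≥0) : ℝ) = 2 * (K + 1) * a := by simp [L]
      simp only [h6, sub_zero, zero_sub, neg_neg, max_self, NNReal.coe_zero]
      rw [hε]
      apply le_of_eq
      field_simp
  obtain ⟨γ, h0, hγ⟩ := hpl.exists_eq_forall_mem_Icc_hasDerivWithinAt₀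
  exact ⟨γ, h0, fun t ht => (hγ t (Ioo_subset_Icc_self ht)).hasDerivAt (Icc_mem_nhds ht.1 ht.2)⟩

theorem LipschitzWith.exists_hasDerivAt {v : E → E} {K : ℝ≥0} (hv : LipschitzWith K v)
    (hv1 : ContDiff ℝ 1 v) (x : E) :
    ∃ γ : ℝ → E, γ 0 = x ∧ ∀ t, HasDerivAt γ (v (γ t)) t := by
  have hε : (0 : ℝ) < 1 / (2 * (K + 1)) := by positivity
  have hloc : ∀ y : E, ∃ γ : ℝ → E, γ 0 = y ∧ IsMIntegralCurveOn (I := 𝓘(ℝ, E)) γ v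
      (Ioo (-(1 / (2 * (K + 1)) : ℝ)) (1 / (2 * (K + 1)))) := by
    intro y
    obtain ⟨γ, h0, hγ⟩ := hv.exists_hasDerivAt_Ioo y
    exact ⟨γ, h0, fun t ht =>
      (hasMFDerivAt_iff_hasFDerivAt.2 (hγ t ht).hasFDerivAt).hasMFDerivWithinAt⟩
  obtain ⟨γ, h0, hγ⟩ := exists_isMIntegralCurve_of_isMIntegralCurveOn (I := 𝓘(ℝ, E)) (v := v)
    (contMDiff_vectorSpace_iff_contDiff.2 hv1) hε hloc x
  refine ⟨γ, h0, fun t => ?_⟩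
  have h : HasFDerivAt γ ((1 : ℝ →L[ℝ] ℝ).smulRight (v (γ t))) t :=
    hasMFDerivAt_iff_hasFDerivAt.1 (hγ t)
  simpa using h.hasDerivAt

/-- A periodic differential equation whose solutions approach each other exponentially has a
periodic solution: the samples `z (n D)` of any solution form a Cauchy sequence, and the solution
that starts at their limit is periodic. -/
theorem exists_periodic_solution {F : ℝ → E → E} {D : ℝ} (hD : 0 < D) {K : ℝ≥0}
    (hF : ∀ t, LipschitzWith K (F t)) (hper : ∀ t x, F (t + D) x = F t x)
    (hex : ∀ x, ∃ z : ℝ → E, z 0 = x ∧ ∀ t, HasDerivAt z (F t (z t)) t)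
    {C κ : ℝ} (hκ : 0 < κ)
    (hstab : ∀ z₁ z₂ : ℝ → E, (∀ t, HasDerivAt z₁ (F t (z₁ t)) t) →
      (∀ t, HasDerivAt z₂ (F t (z₂ t)) t) →
      ∀ t, 0 ≤ t → ‖z₁ t - z₂ t‖ ≤ C * Real.exp (-κ * t) * ‖z₁ 0 - z₂ 0‖) :
    ∃ z : ℝ → E, (∀ t, HasDerivAt z (F t (z t)) t) ∧ Function.Periodic z D := by
  have hshift : ∀ z : ℝ → E, (∀ t, HasDerivAt z (F t (z t)) t) →
      ∀ t, HasDerivAt (fun s => z (s + D)) (F t (z (t + D))) t := by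
    intro z hz t
    rw [← hper]
    exact (hz (t + D)).comp_add_const t D
  obtain ⟨z, -, hz⟩ := hex 0
  have hiter : ∀ n : ℕ, ∀ t, HasDerivAt (fun s => z (s + n * D)) (F t (z (t + n * D))) t := by
    intro n
    induction n with
    | zero => simpa using hz
    | succ n ih =>
      have h := hshift _ ih
      have e : ∀ s : ℝ, s + D + n * D = s + (n + 1 : ℕ) * D := fun s => by push_cast; ring
      simpa only [e] using h
  have hcau : CauchySeq fun n : ℕ => z (n * D) := by
    have hr : Real.exp (-κ * D) < 1 := by
      rw [Real.exp_lt_one_iff]; nlinarith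
    refine cauchySeq_of_le_geometric (Real.exp (-κ * D)) (C * ‖z 0 - z (0 + D)‖) hr fun n => ?_
    have h := hstab z (fun s => z (s + D)) hz (hshift z hz) (n * D) (by positivity)
    have e : Real.exp (-κ * D) ^ n = Real.exp (-κ * (n * D)) := by
      rw [← Real.exp_nat_mul]; ring_nf
    have e' : ((n + 1 : ℕ) : ℝ) * D = n * D + D := by push_cast; ring
    rw [dist_eq_norm, e, e']
    calc _ ≤ _ := h
      _ = _ := by ring
  obtain ⟨a, ha⟩ := cauchySeq_tendsto_of_complete hcau
  obtain ⟨y, hy0, hy⟩ := hex a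
  have hyD : y D = a := by
    have h1 : Tendsto (fun n : ℕ => z ((n + 1 : ℕ) * D)) atTop (𝓝 a) :=
      ha.comp (tendsto_add_atTop_nat 1)
    have h2 : Tendsto (fun n : ℕ => z ((n + 1 : ℕ) * D)) atTop (𝓝 (y D)) := by
      rw [tendsto_iff_norm_sub_tendsto_zero]
      refine squeeze_zero (g := fun n : ℕ => C * Real.exp (-κ * D) * ‖z (n * D) - a‖)
        (fun _ => norm_nonneg _) (fun n => ?_) ?_
      · have h := hstab _ y (hiter n) hy D hD.le
        have e : D + n * D = (n + 1 : ℕ) * D := by push_cast; ring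
        simpa only [e, zero_add, hy0] using h
      · simpa using (tendsto_iff_norm_sub_tendsto_zero.1 ha).const_mul (C * Real.exp (-κ * D))
    exact tendsto_nhds_unique h2 h1
  refine ⟨y, hy, fun t => ?_⟩
  have := ODE_solution_unique_univ (t₀ := 0) (s := fun _ => univ)
    (fun t => (hF t).lipschitzOnWith) (fun t => ⟨hshift y hy t, mem_univ _⟩)
    (fun t => ⟨hy t, mem_univ _⟩) (by simp [hy0, hyD])
  exact congrFun this t

end ODE

/-! ### The closed loop in terms of the data -/

section ClosedLoop

namespace ApproxRegulation

variable {nw n m p nQ r T ℓ : ℕ}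

-- The identity matrix over the stacked index type exceeds the default instance size.
set_option synthInstance.maxSize 2000 in
/-- The data determine the closed loop: since the columns of `[Y1 P1⁻¹, G2]` are annihilated by the
samples of the exosystem state, the unknown disturbance drops out of the data equation. -/
theorem closedLoop_matrix_eq_data (pl : Plant nw n m p nQ) {D : ℝ} (hD : 0 < D)
    (hS : ExosystemPeriodic pl.S D) {γ : ℝ} {N : Fin 2 → ℝ}
    {τ : Fin T → ℝ} {wd : ℝ → Fin nw → ℝ} {ud : ℝ → Fin m → ℝ} {zd : ℝ → StIdx n ℓ p → ℝ}
    (hdata : pl.IsExperiment ℓ D γ N τ wd ud zd)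
    {RQ : Matrix (Fin n) (Fin r) ℝ}
    {P1 : Matrix (StIdx n ℓ p) (StIdx n ℓ p) ℝ} {Y1 : Matrix (Fin T) (StIdx n ℓ p) ℝ}
    {G2 : Matrix (Fin T) (Fin nQ) ℝ} {α : ℝ}
    (hsdp : SDPFeasible (pl.dataZ ℓ τ zd) (dataDeriv τ zd) (modeMatrix pl.S τ) RQ P1 Y1 G2 α) :
    pl.calA ℓ D γ N + pl.calB ℓ * gain (dataU τ ud) P1 Y1 G2 =
      dataDeriv τ zd * Matrix.fromCols (Y1 * P1⁻¹) G2 := by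
  have hZ1 : dataDeriv τ zd = pl.calA ℓ D γ N * pl.dataZ ℓ τ zd + pl.calB ℓ * dataU τ ud +
      pl.calP ℓ γ N * Matrix.of fun i k => wd (τ k) i := by
    ext i k
    have h := (hdata.state k).derivWithin (uniqueDiffWithinAt_Ici _)
    simp only [dataDeriv, Matrix.of_apply, h, Plant.augRHS, Pi.add_apply, Matrix.add_apply]
    rfl
  have hunit : P1 * P1⁻¹ = 1 := by
    rw [Matrix.mul_nonsing_inv _ ((Matrix.isUnit_iff_isUnit_det _).1 hsdp.posDef.isUnit)]
  have hW : ∀ {ι : Type} (Y : Matrix (Fin T) ι ℝ), modeMatrix pl.S τ * Y = 0 →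
      (Matrix.of fun i k => wd (τ k) i) * Y = 0 := by
    intro ι Y hY
    ext i j
    exact hdata.exo.sum_mul_eq_zero hD (hS wd hdata.exo).2 (v := fun k => Y k j)
      (funext fun a => congrFun (congrFun hY a) j) i
  have hm := hsdp.modes
  rw [Matrix.mul_fromCols] at hm
  have hW1 := hW Y1 (by ext i j; exact congrFun (congrFun hm i) (Sum.inl j))
  have hW2 := hW G2 (by ext i j; exact congrFun (congrFun hm i) (Sum.inr j))
  have hZ : pl.dataZ ℓ τ zd * Matrix.fromCols (Y1 * P1⁻¹) G2 = 1 := by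
    rw [Matrix.mul_fromCols, ← Matrix.mul_assoc, hsdp.Z0_Y1, hsdp.Z0_G2, Matrix.fromRows_mul, hunit,
      Matrix.zero_mul, Matrix.fromCols_fromRows_eq_fromBlocks, Matrix.fromBlocks_one]
  have hW0 : (Matrix.of fun i k => wd (τ k) i) * Matrix.fromCols (Y1 * P1⁻¹) G2 = 0 := by
    rw [Matrix.mul_fromCols, ← Matrix.mul_assoc, hW1, hW2, Matrix.zero_mul, Matrix.fromCols_zero]
  rw [hZ1, Matrix.add_mul, Matrix.add_mul, Matrix.mul_assoc, hZ, Matrix.mul_assoc (pl.calP ℓ γ N),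
    hW0, Matrix.mul_one, Matrix.mul_zero, add_zero, Matrix.mul_assoc, gain]

/-- The linear matrix inequality, tested on `(P1⁻¹ δ, d, ℛ_Qᵀ δ)`: an increment `d` of `Q` that is
no larger than the Jacobian bound allows cannot destroy the decay of `δᵀ P1⁻¹ δ`. -/
theorem lmi_increment {Z1 : Matrix (StIdx n ℓ p) (Fin T) ℝ}
    {RQ : Matrix (Fin n) (Fin r) ℝ} {P1 : Matrix (StIdx n ℓ p) (StIdx n ℓ p) ℝ}
    {Y1 : Matrix (Fin T) (StIdx n ℓ p) ℝ} {G2 : Matrix (Fin T) (Fin nQ) ℝ} {α : ℝ}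
    (hP : P1.PosDef) (hlmi : (-lmiMatrix Z1 RQ P1 Y1 G2 α).PosSemidef)
    (δ : StIdx n ℓ p → ℝ) (d : Fin nQ → ℝ)
    (hd : d ⬝ᵥ d ≤ (RQᵀ *ᵥ fun i => δ (Sum.inl i)) ⬝ᵥ (RQᵀ *ᵥ fun i => δ (Sum.inl i))) :
    2 * ((P1⁻¹ *ᵥ δ) ⬝ᵥ (Z1 * Matrix.fromCols (Y1 * P1⁻¹) G2) *ᵥ Sum.elim δ d) ≤
      -α * ((P1⁻¹ *ᵥ δ) ⬝ᵥ (P1⁻¹ *ᵥ δ)) := by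
  set v := P1⁻¹ *ᵥ δ with hv
  set ρ := RQᵀ *ᵥ fun i => δ (Sum.inl i) with hρ
  have hPv : P1 *ᵥ v = δ := by
    rw [hv, Matrix.mulVec_mulVec,
      Matrix.mul_nonsing_inv _ ((Matrix.isUnit_iff_isUnit_det _).1 hP.isUnit), Matrix.one_mulVec]
  have hPsymm : P1ᵀ = P1 := by simpa using hP.isHermitian.eq
  have hR : (P1 * calR ℓ p RQ)ᵀ *ᵥ v = ρ := by
    rw [Matrix.transpose_mul, hPsymm, ← Matrix.mulVec_mulVec, hPv, calR, Matrix.transpose_fromRows,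
      Matrix.fromCols_mulVec]
    simp [hρ, Function.comp_def]
  have key := hlmi.dotProduct_mulVec_nonneg (Sum.elim (Sum.elim v d) ρ)
  have hvR : v ⬝ᵥ ((P1 * calR ℓ p RQ) *ᵥ ρ) = ρ ⬝ᵥ ρ := by
    rw [Matrix.dotProduct_mulVec, ← Matrix.mulVec_transpose, hR]
  have hvG : d ⬝ᵥ ((Z1 * G2)ᵀ *ᵥ v) = v ⬝ᵥ ((Z1 * G2) *ᵥ d) := by
    rw [Matrix.mulVec_transpose, dotProduct_comm, ← Matrix.dotProduct_mulVec]
  have hvY : v ⬝ᵥ ((Z1 * Y1)ᵀ *ᵥ v) = v ⬝ᵥ ((Z1 * Y1) *ᵥ v) := by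
    rw [Matrix.mulVec_transpose, dotProduct_comm, ← Matrix.dotProduct_mulVec]
  simp only [lmiMatrix, Matrix.neg_mulVec, Matrix.fromBlocks_mulVec, Matrix.fromCols_mulVec,
    Matrix.fromRows_mulVec, Sum.elim_comp_inl, Sum.elim_comp_inr, star_trivial, dotProduct_neg,
    sumElim_dotProduct_sumElim, hR, Matrix.add_mulVec, Matrix.smul_mulVec, dotProduct_add,
    Matrix.one_mulVec, Matrix.zero_mulVec, add_zero, dotProduct_smul, smul_eq_mul,
    ← Sum.elim_add_add, hvR, hvG, hvY] at key
  have hgoal : v ⬝ᵥ (Z1 * Matrix.fromCols (Y1 * P1⁻¹) G2) *ᵥ Sum.elim δ d =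
      v ⬝ᵥ ((Z1 * Y1) *ᵥ v) + v ⬝ᵥ ((Z1 * G2) *ᵥ d) := by
    rw [Matrix.mul_fromCols, Matrix.fromCols_mulVec, dotProduct_add, Sum.elim_comp_inl,
      Sum.elim_comp_inr, ← Matrix.mul_assoc, ← Matrix.mulVec_mulVec, ← hv]
  rw [hgoal]
  linarith

end ApproxRegulation

end ClosedLoop

/-! ### Incremental stability -/

section IncrementalStability

theorem HasDerivAt.dotProduct {ι : Type*} [Fintype ι] {u v : ℝ → ι → ℝ} {u' v' : ι → ℝ} {t : ℝ}
    (hu : HasDerivAt u u' t) (hv : HasDerivAt v v' t) :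
    HasDerivAt (fun s => u s ⬝ᵥ v s) (u' ⬝ᵥ v t + u t ⬝ᵥ v') t := by
  have h := HasDerivAt.fun_sum (u := Finset.univ) fun i _ =>
    ((hasDerivAt_pi.1 hu) i).mul ((hasDerivAt_pi.1 hv) i)
  refine h.congr_deriv ?_
  simp only [_root_.dotProduct, Finset.sum_add_distrib]

theorem HasDerivAt.const_mulVec {ι κ : Type*} [Fintype ι] [Fintype κ] (M : Matrix κ ι ℝ)
    {u : ℝ → ι → ℝ} {u' : ι → ℝ} {t : ℝ} (hu : HasDerivAt u u' t) :
    HasDerivAt (fun s => M *ᵥ u s) (M *ᵥ u') t := by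
  refine hasDerivAt_pi.2 fun i => ?_
  have h := (hasDerivAt_const t (M i)).dotProduct hu
  exact h.congr_deriv (by rw [zero_dotProduct, zero_add]; rfl)

theorem norm_sq_le_dotProduct_self {ι : Type*} [Fintype ι] (x : ι → ℝ) : ‖x‖ ^ 2 ≤ x ⬝ᵥ x := by
  have h0 : 0 ≤ x ⬝ᵥ x := Finset.sum_nonneg fun i _ => mul_self_nonneg (x i)
  have h : ‖x‖ ≤ √(x ⬝ᵥ x) := by
    refine (pi_norm_le_iff_of_nonneg (Real.sqrt_nonneg _)).2 fun i => ?_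
    rw [Real.norm_eq_abs]
    refine Real.abs_le_sqrt ?_
    rw [pow_two]
    exact Finset.single_le_sum (f := fun i => x i * x i) (fun i _ => mul_self_nonneg (x i))
      (Finset.mem_univ i)
  calc ‖x‖ ^ 2 ≤ √(x ⬝ᵥ x) ^ 2 := pow_le_pow_left₀ (norm_nonneg _) h 2
    _ = x ⬝ᵥ x := Real.sq_sqrt h0

theorem dotProduct_mulVec_self_le {ι : Type*} [Fintype ι] (M : Matrix ι ι ℝ) (x : ι → ℝ) :
    x ⬝ᵥ M *ᵥ x ≤ (∑ i, ∑ j, |M i j|) * ‖x‖ ^ 2 := by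
  simp only [dotProduct, Matrix.mulVec, Finset.mul_sum, Finset.sum_mul]
  refine Finset.sum_le_sum fun i _ => Finset.sum_le_sum fun j _ => ?_
  have hi : |x i| ≤ ‖x‖ := norm_le_pi_norm x i
  have hj : |x j| ≤ ‖x‖ := norm_le_pi_norm x j
  calc x i * (M i j * x j) ≤ |x i * (M i j * x j)| := le_abs_self _
    _ = |M i j| * (|x i| * |x j|) := by rw [abs_mul, abs_mul]; ring
    _ ≤ |M i j| * (‖x‖ * ‖x‖) := by gcongr
    _ = |M i j| * ‖x‖ ^ 2 := by ring

theorem dotProduct_transpose_mul_self_mulVec {ι κ : Type*} [Fintype ι] [Fintype κ]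
    (M : Matrix κ ι ℝ) (x : ι → ℝ) : x ⬝ᵥ (Mᵀ * M) *ᵥ x = (M *ᵥ x) ⬝ᵥ (M *ᵥ x) := by
  rw [← Matrix.mulVec_mulVec, Matrix.dotProduct_mulVec, Matrix.vecMul_transpose]

/-- If the quadratic form of the inverse of a positive definite matrix dissipates the differences
of two solutions, then solutions approach each other exponentially. -/
theorem exists_exp_contraction {ι : Type*} [Fintype ι] [DecidableEq ι] {f : (ι → ℝ) → ι → ℝ}
    {P : Matrix ι ι ℝ} (hP : P.PosDef) {α : ℝ} (hα : 0 < α)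
    (hdiss : ∀ x y, 2 * ((P⁻¹ *ᵥ (x - y)) ⬝ᵥ (f x - f y)) ≤
      -α * ((P⁻¹ *ᵥ (x - y)) ⬝ᵥ (P⁻¹ *ᵥ (x - y)))) :
    ∃ C κ : ℝ, 0 < κ ∧ ∀ (g : ℝ → ι → ℝ) (z₁ z₂ : ℝ → ι → ℝ),
      (∀ t, 0 ≤ t → HasDerivWithinAt z₁ (f (z₁ t) + g t) (Ici 0) t) →
      (∀ t, 0 ≤ t → HasDerivWithinAt z₂ (f (z₂ t) + g t) (Ici 0) t) →
      ∀ t, 0 ≤ t → ‖z₁ t - z₂ t‖ ≤ C * Real.exp (-κ * t) * ‖z₁ 0 - z₂ 0‖ := by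
  set X := P⁻¹ with hX
  set c : ℝ := (∑ i, ∑ j, |P i j|) + 1 with hc
  set c' : ℝ := ∑ i, ∑ j, |X i j| with hc'
  have hc0 : 0 < c := by positivity
  have hc'0 : 0 ≤ c' := by positivity
  have hPX : P * X = 1 :=
    Matrix.mul_nonsing_inv _ ((Matrix.isUnit_iff_isUnit_det _).1 hP.isUnit)
  have hPsymm : Pᵀ = P := by simpa using hP.isHermitian.eq
  have hXsymm : Xᵀ = X := by rw [hX, Matrix.transpose_nonsing_inv, hPsymm]
  have hsymm : ∀ x y : ι → ℝ, x ⬝ᵥ X *ᵥ y = (X *ᵥ x) ⬝ᵥ y := fun x y => by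
    rw [Matrix.dotProduct_mulVec, ← Matrix.mulVec_transpose, hXsymm]
  have hself : ∀ x : ι → ℝ, 0 ≤ x ⬝ᵥ x := fun x => Finset.sum_nonneg fun i _ =>
    mul_self_nonneg (x i)
  have hPle : ∀ x : ι → ℝ, x ⬝ᵥ P *ᵥ x ≤ c * (x ⬝ᵥ x) := fun x => by
    have h1 := dotProduct_mulVec_self_le P x
    have h2 := norm_sq_le_dotProduct_self x
    have h3 : (0 : ℝ) ≤ ∑ i, ∑ j, |P i j| := by positivity
    have h4 := mul_le_mul_of_nonneg_left h2 h3
    have h5 := hself x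
    rw [hc]
    linarith
  -- With `v = X x`, the form is `v ⬝ P v`.
  have hVle : ∀ x : ι → ℝ, x ⬝ᵥ X *ᵥ x ≤ c * ((X *ᵥ x) ⬝ᵥ (X *ᵥ x)) := fun x => by
    have h := hPle (X *ᵥ x)
    rwa [Matrix.mulVec_mulVec, hPX, Matrix.one_mulVec, dotProduct_comm] at h
  -- The form is nonnegative at `c x - P x`, which bounds it below.
  have hleV : ∀ x : ι → ℝ, x ⬝ᵥ x ≤ c * (x ⬝ᵥ X *ᵥ x) := fun x => by
    have h := hP.inv.posSemidef.dotProduct_mulVec_nonneg (c • x - P *ᵥ x)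
    have hXP : X *ᵥ (P *ᵥ x) = x := by
      rw [Matrix.mulVec_mulVec, hX,
        Matrix.nonsing_inv_mul _ ((Matrix.isUnit_iff_isUnit_det _).1 hP.isUnit), Matrix.one_mulVec]
    have h6 : (P *ᵥ x) ⬝ᵥ (X *ᵥ x) = x ⬝ᵥ x := by
      rw [dotProduct_comm, ← hsymm, hXP]
    simp only [← hX, star_trivial, Matrix.mulVec_sub, Matrix.mulVec_smul, hXP, sub_dotProduct,
      dotProduct_sub, smul_dotProduct, dotProduct_smul, smul_eq_mul, h6] at h
    have h7 : (P *ᵥ x) ⬝ᵥ x ≤ c * (x ⬝ᵥ x) := by rw [dotProduct_comm]; exact hPle x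
    have h8 : 0 ≤ c * (c * (x ⬝ᵥ X *ᵥ x) - x ⬝ᵥ x) := by nlinarith
    linarith [nonneg_of_mul_nonneg_right h8 hc0]
  refine ⟨√(c * c'), α / (2 * c), by positivity, fun g z₁ z₂ h₁ h₂ t ht => ?_⟩
  set κ := α / (2 * c) with hκ
  have hκc : α = 2 * κ * c := by rw [hκ]; field_simp
  set V : ℝ → ℝ := fun s => (z₁ s - z₂ s) ⬝ᵥ X *ᵥ (z₁ s - z₂ s) with hV
  have hcont : ContinuousOn (fun s => Real.exp (2 * κ * s) * V s) (Ici 0) := by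
    have hz : ContinuousOn (fun s => z₁ s - z₂ s) (Ici 0) :=
      ContinuousOn.sub (fun s hs => (h₁ s hs).continuousWithinAt)
        (fun s hs => (h₂ s hs).continuousWithinAt)
    refine ContinuousOn.mul (by fun_prop) ?_
    have hq : Continuous fun x : ι → ℝ => x ⬝ᵥ X *ᵥ x :=
      continuous_id.dotProduct (Continuous.matrix_mulVec continuous_const continuous_id)
    exact hq.comp_continuousOn hz
  have hderiv : ∀ s ∈ interior (Ici (0 : ℝ)), HasDerivAt (fun s => Real.exp (2 * κ * s) * V s)
      (Real.exp (2 * κ * s) * (2 * κ * V s +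
        2 * ((X *ᵥ (z₁ s - z₂ s)) ⬝ᵥ (f (z₁ s) - f (z₂ s))))) s := by
    intro s hs
    rw [interior_Ici] at hs
    have hnhds : Ici (0 : ℝ) ∈ nhds s := Ici_mem_nhds hs
    have hδ : HasDerivAt (fun s => z₁ s - z₂ s) (f (z₁ s) - f (z₂ s)) s :=
      (((h₁ s hs.le).hasDerivAt hnhds).sub ((h₂ s hs.le).hasDerivAt hnhds)).congr_deriv (by abel)
    have hVd := hδ.dotProduct (hδ.const_mulVec X)
    have hexp : HasDerivAt (fun s => Real.exp (2 * κ * s)) (Real.exp (2 * κ * s) * (2 * κ)) s := by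
      simpa using ((hasDerivAt_id s).const_mul (2 * κ)).exp
    refine (hexp.mul hVd).congr_deriv ?_
    rw [hsymm (z₁ s - z₂ s) (f (z₁ s) - f (z₂ s)),
      dotProduct_comm (f (z₁ s) - f (z₂ s))]
    ring
  have hanti : AntitoneOn (fun s => Real.exp (2 * κ * s) * V s) (Ici 0) := by
    refine antitoneOn_of_deriv_nonpos (convex_Ici 0) hcont
      (fun s hs => (hderiv s hs).differentiableAt.differentiableWithinAt) fun s hs => ?_
    rw [(hderiv s hs).deriv]
    refine mul_nonpos_of_nonneg_of_nonpos (Real.exp_pos _).le ?_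
    have h := hdiss (z₁ s) (z₂ s)
    have h' := mul_le_mul_of_nonneg_left (hVle (z₁ s - z₂ s)) (by positivity : 0 ≤ 2 * κ)
    rw [hκc] at h
    simp only [hV]
    linarith
  have hfin := hanti (mem_Ici.2 le_rfl) (mem_Ici.2 ht) ht
  simp only [mul_zero, Real.exp_zero, one_mul] at hfin
  have h0 : V 0 ≤ c' * ‖z₁ 0 - z₂ 0‖ ^ 2 := dotProduct_mulVec_self_le X _
  have hexp : Real.exp (-κ * t) ^ 2 * Real.exp (2 * κ * t) = 1 := by
    rw [← Real.exp_nat_mul, ← Real.exp_add, ← Real.exp_zero]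
    congr 1
    push_cast
    ring
  have hVt : V t ≤ Real.exp (-κ * t) ^ 2 * (c' * ‖z₁ 0 - z₂ 0‖ ^ 2) := by
    calc V t = Real.exp (-κ * t) ^ 2 * (Real.exp (2 * κ * t) * V t) := by
          rw [← mul_assoc, hexp, one_mul]
      _ ≤ _ := mul_le_mul_of_nonneg_left (hfin.trans h0) (by positivity)
  refine (pow_le_pow_iff_left₀ (norm_nonneg _) (by positivity) two_ne_zero).1 ?_
  calc ‖z₁ t - z₂ t‖ ^ 2 ≤ (z₁ t - z₂ t) ⬝ᵥ (z₁ t - z₂ t) := norm_sq_le_dotProduct_self _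
    _ ≤ c * V t := hleV _
    _ ≤ c * (Real.exp (-κ * t) ^ 2 * (c' * ‖z₁ 0 - z₂ 0‖ ^ 2)) :=
        mul_le_mul_of_nonneg_left hVt hc0.le
    _ = (√(c * c') * Real.exp (-κ * t) * ‖z₁ 0 - z₂ 0‖) ^ 2 := by
        rw [mul_pow, mul_pow, Real.sq_sqrt (by positivity)]
        ring

end IncrementalStability

/-! ### Increments of the nonlinearity -/

section Increment

namespace ApproxRegulation

/-- The bound on the Jacobian integrates to a bound on increments: apply the mean value theorem to
the projection of `Q` on the direction `Q x - Q y`. -/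
theorem JacobianBound.increment_le {n nQ r : ℕ} {Q : (Fin n → ℝ) → Fin nQ → ℝ}
    (hQ : Differentiable ℝ Q) {RQ : Matrix (Fin n) (Fin r) ℝ} (hRQ : JacobianBound Q RQ)
    (x y : Fin n → ℝ) :
    (Q x - Q y) ⬝ᵥ (Q x - Q y) ≤ (RQᵀ *ᵥ (x - y)) ⬝ᵥ (RQᵀ *ᵥ (x - y)) := by
  set u := Q x - Q y with hu
  have hd : ∀ s : ℝ, HasDerivAt (fun s : ℝ => u ⬝ᵥ Q (y + s • (x - y)))
      (u ⬝ᵥ (jacobian Q (y + s • (x - y)) *ᵥ (x - y))) s := by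
    intro s
    have hl : HasDerivAt (fun s : ℝ => y + s • (x - y)) (x - y) s := by
      simpa using ((hasDerivAt_id s).smul_const (x - y)).const_add y
    have h := (hasDerivAt_const s u).dotProduct ((hQ _).hasFDerivAt.comp_hasDerivAt s hl)
    refine h.congr_deriv ?_
    rw [jacobian, LinearMap.toMatrix'_mulVec]
    simp
  obtain ⟨s, -, hs⟩ := exists_hasDerivAt_eq_slope _ _ (zero_lt_one' ℝ)
    (fun s _ => (hd s).continuousAt.continuousWithinAt) (fun s _ => hd s)
  set a := jacobian Q (y + s • (x - y)) *ᵥ (x - y) with ha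
  have hua : u ⬝ᵥ a = u ⬝ᵥ u := by
    rw [hs, hu]
    simp [dotProduct_sub]
  have haR : a ⬝ᵥ a ≤ (RQᵀ *ᵥ (x - y)) ⬝ᵥ (RQᵀ *ᵥ (x - y)) := by
    have h := (hRQ (y + s • (x - y))).dotProduct_mulVec_nonneg (x - y)
    have hR := dotProduct_transpose_mul_self_mulVec RQᵀ (x - y)
    rw [Matrix.transpose_transpose] at hR
    rw [Matrix.sub_mulVec, dotProduct_sub, star_trivial, hR,
      dotProduct_transpose_mul_self_mulVec] at h
    linarith
  have hle : ∀ b d : Fin nQ → ℝ, b ⬝ᵥ d = b ⬝ᵥ b → b ⬝ᵥ b ≤ d ⬝ᵥ d := by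
    intro b d h
    have h0 : 0 ≤ (b - d) ⬝ᵥ (b - d) := Finset.sum_nonneg fun i _ => mul_self_nonneg _
    rw [sub_dotProduct, dotProduct_sub, dotProduct_sub, dotProduct_comm d b, h] at h0
    linarith
  exact (hle u a hua).trans haR

theorem JacobianBound.exists_lipschitzWith {n nQ r : ℕ} {Q : (Fin n → ℝ) → Fin nQ → ℝ}
    (hQ : Differentiable ℝ Q) {RQ : Matrix (Fin n) (Fin r) ℝ} (hRQ : JacobianBound Q RQ) :
    ∃ K, LipschitzWith K Q := by
  refine ⟨_, LipschitzWith.of_dist_le_mul 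
    (K := Real.toNNReal √(∑ i, ∑ j, |(RQ * RQᵀ) i j|)) fun x y => ?_⟩
  rw [dist_eq_norm, dist_eq_norm, Real.coe_toNNReal _ (Real.sqrt_nonneg _)]
  refine (pow_le_pow_iff_left₀ (norm_nonneg _) (by positivity) two_ne_zero).1 ?_
  rw [mul_pow, Real.sq_sqrt (by positivity)]
  refine (norm_sq_le_dotProduct_self _).trans ((hRQ.increment_le hQ x y).trans ?_)
  refine le_trans (le_of_eq ?_) (dotProduct_mulVec_self_le _ _)
  simpa using (dotProduct_transpose_mul_self_mulVec RQᵀ (x - y)).symm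

end ApproxRegulation

end Increment

/-! ### The internal model and the spectrum of the regulation error -/

section InternalModel

/-- A periodic response of a resonant linear system excludes the resonance frequency from the
spectrum of its input. -/
theorem fourierCoeffOn_eq_zero_of_resonance {D : ℝ} (hD : 0 < D) {ζ e : ℝ → ℂ} {ν : ℂ}
    (hν : ν ≠ 0) (n : ℤ)
    (hζ : ∀ t, HasDerivAt ζ ((2 * Real.pi * Complex.I * n / D) * ζ t + ν * e t) t)
    (he : Continuous e) (hper : ζ D = ζ 0) : fourierCoeffOn hD e n = 0 := by
  have hζc : Continuous ζ := continuous_iff_continuousAt.2 fun t => (hζ t).continuousAt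
  have h1 := fourierCoeffOn_deriv_of_eq hD hζ (by fun_prop) hper n
  have h2 := fourierCoeffOn_sum_const_mul hD ![(2 * Real.pi * Complex.I * n / D : ℂ), ν]
    (f := ![ζ, e]) (by intro i; fin_cases i <;> assumption) n
  simp only [Fin.sum_univ_two, Matrix.cons_val_zero, Matrix.cons_val_one] at h2
  rw [h2] at h1
  have h3 : ν * fourierCoeffOn hD e n = 0 := by linear_combination h1
  exact (mul_eq_zero.1 h3).resolve_left hν

namespace ApproxRegulation

variable {nw n m p nQ ℓ : ℕ}

/-- The components of the internal model within the augmented system: `η' = Φ η + G e`, block by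
block. -/
theorem Plant.augRHS_inr (pl : Plant nw n m p nQ) (D γ : ℝ) (N : Fin 2 → ℝ)
    (z : StIdx n ℓ p → ℝ) (u : Fin m → ℝ) (w : Fin nw → ℝ) (o : OscIdx ℓ) (j : Fin p) :
    pl.augRHS ℓ D γ N z u w (Sum.inr (o, j)) =
      (phi ℓ D *ᵥ fun o' => z (Sum.inr (o', j))) o +
        Gam ℓ γ N o * pl.err (fun i => z (Sum.inl i)) w j := by
  have hG : ∀ v : Fin p → ℝ, (bigG ℓ p γ N *ᵥ v) (o, j) = Gam ℓ γ N o * v j := by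
    intro v
    simp [bigG, Matrix.mulVec, dotProduct]
  have hΦ : (bigPhi ℓ p D *ᵥ fun i => z (Sum.inr i)) (o, j) =
      (phi ℓ D *ᵥ fun o' => z (Sum.inr (o', j))) o := by
    simp only [bigPhi, Matrix.mulVec, dotProduct, Fintype.sum_prod_type, Matrix.blockDiagonal_apply]
    refine Finset.sum_congr rfl fun o' _ => ?_
    simp
  have hCe : pl.Ce *ᵥ Sum.elim (fun i => z (Sum.inl i)) (pl.Q fun i => z (Sum.inl i)) =
      pl.Ce.toCols₁ *ᵥ (fun i => z (Sum.inl i)) +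
        pl.Ce.toCols₂ *ᵥ (pl.Q fun i => z (Sum.inl i)) := by
    conv_lhs => rw [← Matrix.fromCols_toCols pl.Ce]
    rw [Matrix.fromCols_mulVec]
    rfl
  have hA : (pl.calA ℓ D γ N *ᵥ pl.calZ ℓ z) (Sum.inr (o, j)) =
      (bigG ℓ p γ N *ᵥ (pl.Ce.toCols₁ *ᵥ fun i => z (Sum.inl i))) (o, j) +
        (bigPhi ℓ p D *ᵥ fun i => z (Sum.inr i)) (o, j) +
        (bigG ℓ p γ N *ᵥ (pl.Ce.toCols₂ *ᵥ pl.Q fun i => z (Sum.inl i))) (o, j) := by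
    rw [Plant.calA, Plant.calZ, Matrix.fromCols_mulVec, Matrix.fromBlocks_mulVec,
      Matrix.fromRows_mulVec, Matrix.mulVec_mulVec, Matrix.mulVec_mulVec]
    rfl
  have hB : (pl.calB ℓ (p := p) *ᵥ u) (Sum.inr (o, j)) = 0 := by
    rw [Plant.calB, Matrix.fromRows_mulVec, Sum.elim_inr, Matrix.zero_mulVec, Pi.zero_apply]
  have hP : (pl.calP ℓ γ N *ᵥ w) (Sum.inr (o, j)) =
      (bigG ℓ p γ N *ᵥ (pl.Qe *ᵥ w)) (o, j) := by
    rw [Plant.calP, Matrix.fromRows_mulVec, Sum.elim_inr, Matrix.mulVec_mulVec]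
  rw [Plant.augRHS, Pi.add_apply, Pi.add_apply, hA, hB, hP, hΦ, hG, hG, hG, Plant.err, hCe]
  simp only [Pi.add_apply]
  ring

theorem phi_mulVec_inl {D : ℝ} (v : OscIdx ℓ → ℝ) : (phi ℓ D *ᵥ v) (Sum.inl ()) = 0 := by
  simp [phi, Matrix.fromBlocks_mulVec]

theorem phi_mulVec_inr {D : ℝ} (v : OscIdx ℓ → ℝ) (i : Fin 2) (k : Fin ℓ) :
    (phi ℓ D *ᵥ v) (Sum.inr (i, k)) =
      (oscBlock (((k : ℕ) + 1 : ℝ) * (2 * Real.pi / D)) *ᵥ fun i' => v (Sum.inr (i', k))) i := by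
  simp [phi, Matrix.mulVec, dotProduct, Fintype.sum_prod_type,
    Matrix.blockDiagonal_apply]

/-- Along a periodic solution, the integrator and the oscillators of the internal model remove the
harmonics of order up to `ℓ` from the regulation error. -/
theorem Plant.fourierCoeffOn_err_eq_zero (pl : Plant nw n m p nQ) {D : ℝ} (hD : 0 < D) {γ : ℝ}
    (hγ : γ ≠ 0) {N : Fin 2 → ℝ} (hN : N ≠ 0) {z : ℝ → StIdx n ℓ p → ℝ} {u : ℝ → Fin m → ℝ}
    {w : ℝ → Fin nw → ℝ} (hz : ∀ t, HasDerivAt z (pl.augRHS ℓ D γ N (z t) (u t) (w t)) t)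
    (hper : Function.Periodic z D)
    (he : Continuous fun t => pl.err (fun i => z t (Sum.inl i)) (w t)) (j : Fin p) (k : ℤ)
    (hk : k.natAbs ≤ ℓ) :
    fourierCoeffOn hD
      (fun t => ((pl.err (fun i => z t (Sum.inl i)) (w t) j : ℝ) : ℂ)) k = 0 := by
  have hec : Continuous fun t => ((pl.err (fun i => z t (Sum.inl i)) (w t) j : ℝ) : ℂ) :=
    Complex.continuous_ofReal.comp ((continuous_apply j).comp he)
  have hη : ∀ o t, HasDerivAt (fun t => z t (Sum.inr (o, j)))
      ((phi ℓ D *ᵥ fun o' => z t (Sum.inr (o', j))) o +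
        Gam ℓ γ N o * pl.err (fun i => z t (Sum.inl i)) (w t) j) t := by
    intro o t
    rw [← pl.augRHS_inr D γ N (z t) (u t) (w t) o j]
    exact hasDerivAt_pi.1 (hz t) _
  have hzD : z D = z 0 := by simpa using hper 0
  rcases eq_or_ne k 0 with rfl | hk0
  · refine fourierCoeffOn_eq_zero_of_resonance hD (ν := γ) (by exact_mod_cast hγ) 0
      (ζ := fun t => (z t (Sum.inr (Sum.inl (), j)) : ℂ)) (fun t => ?_) hec (by simp [hzD])
    have h := (hη (Sum.inl ()) t).ofReal_comp
    rw [phi_mulVec_inl] at h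
    simpa [Gam] using h
  · -- The sign of `k` selects one of the two conjugate eigenvectors of the oscillator.
    obtain ⟨i, s, hs, hsk⟩ : ∃ (i : Fin ℓ) (s : ℝ), s * s = 1 ∧ (k : ℝ) = s * ((i : ℕ) + 1) := by
      obtain ⟨a, ha⟩ : ∃ a : ℕ, k.natAbs = a + 1 := ⟨k.natAbs - 1, by omega⟩
      rcases hk0.lt_or_gt with h | h
      · have hka : k = -((a : ℤ) + 1) := by omega
        have hkr : (k : ℝ) = -((a : ℝ) + 1) := by rw [hka]; push_cast; ring
        exact ⟨⟨a, by omega⟩, -1, by norm_num, hkr.trans (by simp)⟩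
      · have hka : k = (a : ℤ) + 1 := by omega
        have hkr : (k : ℝ) = (a : ℝ) + 1 := by rw [hka]; push_cast; ring
        exact ⟨⟨a, by omega⟩, 1, by norm_num, hkr.trans (by simp)⟩
    have hν : (N 0 - s * Complex.I * N 1 : ℂ) ≠ 0 := by
      intro h
      have h0 : N 0 = 0 := by simpa using congrArg Complex.re h
      have h1 : s * N 1 = 0 := by simpa using congrArg Complex.im h
      have hs0 : s ≠ 0 := by rintro rfl; simp at hs
      apply hN
      ext a
      fin_cases a
      · exact h0
      · exact (mul_eq_zero.1 h1).resolve_left hs0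
    refine fourierCoeffOn_eq_zero_of_resonance hD hν k
      (ζ := fun t => (z t (Sum.inr (Sum.inr (0, i), j)) : ℂ) -
        s * Complex.I * (z t (Sum.inr (Sum.inr (1, i), j)) : ℂ)) (fun t => ?_) hec (by simp [hzD])
    have h0 := (hη (Sum.inr (0, i)) t).ofReal_comp
    have h1 := ((hη (Sum.inr (1, i)) t).ofReal_comp).const_mul (s * Complex.I : ℂ)
    rw [phi_mulVec_inr] at h0 h1
    refine (h0.sub h1).congr_deriv ?_
    have hkc : (k : ℂ) = s * ((i : ℕ) + 1) := by exact_mod_cast congrArg (fun x : ℝ => (x : ℂ)) hsk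
    have hsc : (s : ℂ) * s = 1 := by exact_mod_cast hs
    simp only [oscBlock, Gam, Matrix.mulVec, dotProduct, Fin.sum_univ_two, Matrix.of_apply,
      Matrix.cons_val_zero, Matrix.cons_val_one, Sum.elim_inr, hkc]
    push_cast
    have hI := Complex.I_mul_I
    set A : ℂ := ((z t (Sum.inr (Sum.inr (0, i), j)) : ℝ) : ℂ)
    set B : ℂ := ((z t (Sum.inr (Sum.inr (1, i), j)) : ℝ) : ℂ)
    linear_combination (2 * Real.pi / D * ((i : ℕ) + 1) * B : ℂ) * ((s : ℂ) ^ 2 * hI - hsc)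

end ApproxRegulation

end InternalModel

/-! ### The mean square of a signal without low harmonics -/

section MeanSquare

open MeasureTheory

/-- The mean-square bound for vector signals, with the mean square of the derivative estimated by the
square of its supremum. -/
theorem exists_isLUB_and_meanSquare_le {p : ℕ} {D : ℝ} (hD : 0 < D) (l : ℕ) {e : ℝ → Fin p → ℝ}
    (he : ContDiff ℝ 1 e) (hper : Function.Periodic e D)
    (hcoeff : ∀ (j : Fin p) (k : ℤ), k.natAbs ≤ l →
      fourierCoeffOn hD (fun t => ((e t j : ℝ) : ℂ)) k = 0) :
    ∃ eBar : ℝ, IsLUB (range fun t : ℝ => ‖WithLp.toLp 2 (deriv e t)‖) eBar ∧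
      (1 / D) * ∫ t in (0 : ℝ)..D, ‖WithLp.toLp 2 (e t)‖ ^ 2 ≤
        eBar ^ 2 / ((2 * Real.pi / D) ^ 2 * ((l : ℝ) + 1) ^ 2) := by
  have hd : ∀ t, HasDerivAt e (deriv e t) t := fun t =>
    (he.differentiable one_ne_zero t).hasDerivAt
  have hdc : Continuous (deriv e) := he.continuous_deriv le_rfl
  have hdper : Function.Periodic (deriv e) D := fun t => by
    rw [← deriv_comp_add_const]
    exact congrArg (fun g => deriv g t) (funext hper)
  have hnc : Continuous fun t : ℝ => ‖WithLp.toLp 2 (deriv e t)‖ :=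
    ((PiLp.continuous_toLp 2 _).comp hdc).norm
  have hnper : Function.Periodic (fun t : ℝ => ‖WithLp.toLp 2 (deriv e t)‖) D := fun t => by
    simp only [hdper t]
  have hlub := isLUB_csSup (range_nonempty fun t : ℝ => ‖WithLp.toLp 2 (deriv e t)‖)
    (hnper.compact_of_continuous hD.ne' hnc).bddAbove
  refine ⟨_, hlub, ?_⟩
  set eBar := sSup (range fun t : ℝ => ‖WithLp.toLp 2 (deriv e t)‖)
  have hcomp : ∀ j, ((2 * Real.pi / D) * (l + 1)) ^ 2 * ∫ t in (0 : ℝ)..D, e t j ^ 2 ≤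
      ∫ t in (0 : ℝ)..D, deriv e t j ^ 2 := by
    intro j
    have h := wirtinger_of_fourierCoeffOn_eq_zero hD
      (f := fun t => ((e t j : ℝ) : ℂ)) (f' := fun t => ((deriv e t j : ℝ) : ℂ))
      (fun t => (hasDerivAt_pi.1 (hd t) j).ofReal_comp)
      (Complex.continuous_ofReal.comp ((continuous_apply j).comp hdc))
      (by have := hper 0; rw [zero_add] at this; simp [this]) l (hcoeff j)
    simpa using h
  have hsum : ∀ g : ℝ → Fin p → ℝ, Continuous g →
      ∫ t in (0 : ℝ)..D, ‖WithLp.toLp 2 (g t)‖ ^ 2 = ∑ j, ∫ t in (0 : ℝ)..D, g t j ^ 2 := by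
    intro g hg
    rw [← intervalIntegral.integral_finsetSum]
    · simp [EuclideanSpace.real_norm_sq_eq]
    · intro j _
      exact (((continuous_apply j).comp hg).pow 2).intervalIntegrable _ _
  have htot : ((2 * Real.pi / D) * (l + 1)) ^ 2 * ∫ t in (0 : ℝ)..D, ‖WithLp.toLp 2 (e t)‖ ^ 2 ≤
      ∫ t in (0 : ℝ)..D, ‖WithLp.toLp 2 (deriv e t)‖ ^ 2 := by
    rw [hsum e he.continuous, hsum _ hdc, Finset.mul_sum]
    exact Finset.sum_le_sum fun j _ => hcomp j
  have hbar : ∫ t in (0 : ℝ)..D, ‖WithLp.toLp 2 (deriv e t)‖ ^ 2 ≤ D * eBar ^ 2 := by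
    have h := intervalIntegral.integral_mono_on (μ := volume) hD.le ((hnc.pow 2).intervalIntegrable 0 D)
      ((continuous_const (y := eBar ^ 2)).intervalIntegrable 0 D)
      (fun t _ => pow_le_pow_left₀ (norm_nonneg _) (hlub.1 (mem_range_self t)) 2)
    simpa using h
  have hpos : 0 < (2 * Real.pi / D) ^ 2 * ((l : ℝ) + 1) ^ 2 := by positivity
  rw [le_div_iff₀ hpos, ← mul_pow, mul_comm, mul_left_comm, one_div, inv_mul_le_iff₀ hD]
  exact htot.trans hbar

end MeanSquare

/-! ### The closed-loop vector field -/

section ClosedLoopField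

open scoped NNReal

theorem Matrix.exists_lipschitzWith_mulVec {ι κ : Type*} [Fintype ι] [Fintype κ]
    (M : Matrix κ ι ℝ) : ∃ K : ℝ≥0, LipschitzWith K fun x : ι → ℝ => M *ᵥ x :=
  ⟨_, (LinearMap.toContinuousLinearMap M.mulVecLin).lipschitz⟩

theorem Matrix.contDiff_mulVec {ι κ : Type*} [Fintype ι] [Fintype κ] (M : Matrix κ ι ℝ) :
    ContDiff ℝ 1 fun x : ι → ℝ => M *ᵥ x :=
  (LinearMap.toContinuousLinearMap M.mulVecLin).contDiff

theorem LipschitzWith.sumElim {E ι κ : Type*} [PseudoMetricSpace E] [Fintype ι] [Fintype κ]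
    {f : E → ι → ℝ} {g : E → κ → ℝ} {Kf Kg : ℝ≥0} (hf : LipschitzWith Kf f)
    (hg : LipschitzWith Kg g) : LipschitzWith (max Kf Kg) fun x => Sum.elim (f x) (g x) := by
  refine LipschitzWith.of_dist_le_mul fun x y => (dist_pi_le_iff (by positivity)).2 fun i => ?_
  rcases i with i | i
  · exact (dist_le_pi_dist _ _ i).trans (((hf.weaken (le_max_left _ _)).dist_le_mul x y))
  · exact (dist_le_pi_dist _ _ i).trans (((hg.weaken (le_max_right _ _)).dist_le_mul x y))

theorem ContDiff.sumElim {E ι κ : Type*} [NormedAddCommGroup E] [NormedSpace ℝ E] [Fintype ι]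
    [Fintype κ] {f : E → ι → ℝ} {g : E → κ → ℝ} (hf : ContDiff ℝ 1 f) (hg : ContDiff ℝ 1 g) :
    ContDiff ℝ 1 fun x => Sum.elim (f x) (g x) := by
  refine contDiff_pi.2 fun i => ?_
  rcases i with i | i
  · exact contDiff_pi.1 hf i
  · exact contDiff_pi.1 hg i

namespace ApproxRegulation

/-- An exosystem trajectory and the closed loop that it drives form an autonomous system with a
Lipschitz field, so solutions exist globally. -/
theorem exists_solution_of_exosystem {ι : Type*} [Fintype ι] {nw : ℕ}
    {S : Matrix (Fin nw) (Fin nw) ℝ} {w : ℝ → Fin nw → ℝ} (hw : IsExosystemSolution S w)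
    {f : (ι → ℝ) → ι → ℝ} {K : ℝ≥0} (hf : LipschitzWith K f) (hf1 : ContDiff ℝ 1 f)
    (M : Matrix ι (Fin nw) ℝ) (z₀ : ι → ℝ) :
    ∃ z : ℝ → ι → ℝ, z 0 = z₀ ∧ ∀ t, HasDerivAt z (f (z t) + M *ᵥ w t) t := by
  obtain ⟨KM, hM⟩ := M.exists_lipschitzWith_mulVec
  obtain ⟨KS, hS⟩ := S.exists_lipschitzWith_mulVec
  have hL := ((hf.comp LipschitzWith.prod_fst).add (hM.comp LipschitzWith.prod_snd)).prodMk
    (hS.comp (LipschitzWith.prod_snd (α := ι → ℝ)))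
  have hC : ContDiff ℝ 1 fun y : (ι → ℝ) × (Fin nw → ℝ) => (f y.1 + M *ᵥ y.2, S *ᵥ y.2) :=
    ((hf1.comp contDiff_fst).add (M.contDiff_mulVec.comp contDiff_snd)).prodMk
      (S.contDiff_mulVec.comp contDiff_snd)
  obtain ⟨y, hy0, hy⟩ := LipschitzWith.exists_hasDerivAt hL hC (z₀, w 0)
  have hyw : (fun t => (y t).2) = w :=
    ODE_solution_unique_univ (t₀ := 0) (v := fun _ x => S *ᵥ x) (s := fun _ => univ)
      (fun _ => hS.lipschitzOnWith) (fun t => ⟨(hy t).snd, mem_univ _⟩)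
      (fun t => ⟨hw t, mem_univ _⟩) (by simp [hy0])
  refine ⟨fun t => (y t).1, by simp [hy0], fun t => ?_⟩
  rw [← hyw]
  exact (hy t).fst

end ApproxRegulation

end ClosedLoopField

/-! ### Approximate regulation -/

theorem mainTheorem1 {nw n m p nQ r T ℓ : ℕ}
    (pl : Plant nw n m p nQ) (hQ : ContDiff ℝ 1 pl.Q)
    -- the exosystem and the internal model
    (D : ℝ) (hD : 0 < D) (hS : ExosystemPeriodic pl.S D)
    (γ : ℝ) (hγ : γ ≠ 0) (N : Fin 2 → ℝ) (hN : N ≠ 0)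
    -- the dataset
    (τ : Fin T → ℝ) (wd : ℝ → Fin nw → ℝ) (ud : ℝ → Fin m → ℝ) (zd : ℝ → StIdx n ℓ p → ℝ)
    (hdata : pl.IsExperiment ℓ D γ N τ wd ud zd)
    -- the semidefinite program
    (RQ : Matrix (Fin n) (Fin r) ℝ) (hRQ : JacobianBound pl.Q RQ)
    (P1 : Matrix (StIdx n ℓ p) (StIdx n ℓ p) ℝ) (Y1 : Matrix (Fin T) (StIdx n ℓ p) ℝ)
    (G2 : Matrix (Fin T) (Fin nQ) ℝ) (α : ℝ)
    (hsdp : SDPFeasible (pl.dataZ ℓ τ zd) (dataDeriv τ zd) (modeMatrix pl.S τ) RQ P1 Y1 G2 α)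
    -- the controller gain
    (K : Matrix (Fin m) (StIdx n ℓ p ⊕ Fin nQ) ℝ) (hK : K = gain (dataU τ ud) P1 Y1 G2)
    -- the exosystem trajectory that drives the closed loop
    (w : ℝ → Fin nw → ℝ) (hw : IsExosystemSolution pl.S w) :
    -- from every initial state there is a closed-loop solution for all `t ≥ 0`
    (∀ z₀ : StIdx n ℓ p → ℝ, ∃ z : ℝ → StIdx n ℓ p → ℝ,
      z 0 = z₀ ∧ pl.IsClosedLoopSolution ℓ D γ N K w z) ∧
    -- every closed-loop solution is bounded
    (∀ z : ℝ → StIdx n ℓ p → ℝ, pl.IsClosedLoopSolution ℓ D γ N K w z →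
      Bornology.IsBounded (z '' Ici 0)) ∧
    ∃ eStar : ℝ → Fin p → ℝ,
      Bornology.IsBounded (range eStar) ∧ Function.Periodic eStar D ∧ ContDiff ℝ 1 eStar ∧
      -- the error along every closed-loop solution converges to `eStar` exponentially
      (∃ rate : ℝ, 0 < rate ∧
        ∀ z : ℝ → StIdx n ℓ p → ℝ, pl.IsClosedLoopSolution ℓ D γ N K w z →
          ∃ c : ℝ, ∀ t : ℝ, 0 ≤ t →
            ‖pl.err (fun i => z t (Sum.inl i)) (w t) - eStar t‖ ≤ c * Real.exp (-rate * t)) ∧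
      -- the bound on the mean square of `eStar`, with the supremum of the norm of its derivative
      ∃ eBar : ℝ,
        IsLUB (range fun t : ℝ => ‖WithLp.toLp 2 (deriv eStar t)‖) eBar ∧
        (1 / D) * ∫ t in (0 : ℝ)..D, ‖WithLp.toLp 2 (eStar t)‖ ^ 2 ≤
          eBar ^ 2 / ((2 * Real.pi / D) ^ 2 * ((ℓ : ℝ) + 1) ^ 2) := by
  have hQd : Differentiable ℝ pl.Q := hQ.differentiable one_ne_zero
  obtain ⟨KQ, hKQ⟩ := hRQ.exists_lipschitzWith hQd
  -- The closed loop is `z' = f z + 𝒫 w`, where `f` is known from the data alone.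
  set M := dataDeriv τ zd * Matrix.fromCols (Y1 * P1⁻¹) G2 with hM
  have hMK : pl.calA ℓ D γ N + pl.calB ℓ * K = M := by
    rw [hK]
    exact closedLoop_matrix_eq_data pl hD hS hdata hsdp
  set f : (StIdx n ℓ p → ℝ) → StIdx n ℓ p → ℝ := fun z => M *ᵥ pl.calZ ℓ z with hf
  have hrhs : ∀ z w', pl.augRHS ℓ D γ N z (K *ᵥ pl.calZ ℓ z) w' =
      f z + pl.calP ℓ γ N *ᵥ w' := by
    intro z w'
    rw [Plant.augRHS, Matrix.mulVec_mulVec, ← Matrix.add_mulVec, hMK]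
  have hfst : LipschitzWith 1 fun (z : StIdx n ℓ p → ℝ) (i : Fin n) => z (Sum.inl i) :=
    LipschitzWith.of_dist_le_mul fun x y => (dist_pi_le_iff (by positivity)).2 fun i => by
      simpa using dist_le_pi_dist x y (Sum.inl i)
  have hfst1 : ContDiff ℝ 1 fun (z : StIdx n ℓ p → ℝ) (i : Fin n) => z (Sum.inl i) :=
    contDiff_pi.2 fun i => contDiff_apply ℝ ℝ (Sum.inl i)
  obtain ⟨Kf, hfL⟩ : ∃ Kf, LipschitzWith Kf f := by
    obtain ⟨KM, hKM⟩ := M.exists_lipschitzWith_mulVec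
    exact ⟨_, hKM.comp (LipschitzWith.id.sumElim (hKQ.comp hfst))⟩
  have hf1 : ContDiff ℝ 1 f :=
    M.contDiff_mulVec.comp (contDiff_id.sumElim (hQ.comp hfst1))
  have hex := exists_solution_of_exosystem hw hfL hf1 (pl.calP ℓ γ N)
  obtain ⟨C, κ, hκ, hstab⟩ := exists_exp_contraction (f := f) hsdp.posDef hsdp.alpha_pos
    fun x y => by
      have hfd : f x - f y = M *ᵥ Sum.elim (x - y)
          ((pl.Q fun i => x (Sum.inl i)) - pl.Q fun i => y (Sum.inl i)) := by
        rw [Sum.elim_sub_sub, Matrix.mulVec_sub]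
        rfl
      rw [hfd]
      exact lmi_increment hsdp.posDef hsdp.lmi (x - y) _
        (hRQ.increment_le hQd (fun i => x (Sum.inl i)) fun i => y (Sum.inl i))
  have hloop : ∀ z, pl.IsClosedLoopSolution ℓ D γ N K w z → ∀ t, 0 ≤ t →
      HasDerivWithinAt z (f (z t) + pl.calP ℓ γ N *ᵥ w t) (Ici 0) t := fun z hz t ht => by
    rw [← hrhs]
    exact hz t ht
  obtain ⟨-, hwper⟩ := hS w hw
  obtain ⟨zs, hzs, hzsper⟩ := exists_periodic_solution
    (F := fun t z => f z + pl.calP ℓ γ N *ᵥ w t) hD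
    (fun t => by simpa using hfL.add (LipschitzWith.const (pl.calP ℓ γ N *ᵥ w t)))
    (fun t x => by rw [hwper t]) hex hκ
    (fun z₁ z₂ h₁ h₂ => hstab _ z₁ z₂ (fun t _ => (h₁ t).hasDerivWithinAt)
      fun t _ => (h₂ t).hasDerivWithinAt)
  have hconv : ∀ z, pl.IsClosedLoopSolution ℓ D γ N K w z → ∀ t, 0 ≤ t →
      ‖z t - zs t‖ ≤ C * Real.exp (-κ * t) * ‖z 0 - zs 0‖ := fun z hz =>
    hstab _ z zs (hloop z hz) fun t _ => (hzs t).hasDerivWithinAt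
  have hwc : Continuous w := continuous_iff_continuousAt.2 fun t => (hw t).continuousAt
  have hzsc : Continuous zs := continuous_iff_continuousAt.2 fun t => (hzs t).continuousAt
  have hw1 : ContDiff ℝ 1 w := by
    refine contDiff_one_iff_deriv.2 ⟨fun t => (hw t).differentiableAt, ?_⟩
    rw [funext fun t => (hw t).deriv]
    exact pl.S.contDiff_mulVec.continuous.comp hwc
  have hzs1 : ContDiff ℝ 1 zs := by
    refine contDiff_one_iff_deriv.2 ⟨fun t => (hzs t).differentiableAt, ?_⟩
    rw [funext fun t => (hzs t).deriv]
    exact (hf1.continuous.comp hzsc).add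
      ((pl.calP ℓ γ N).contDiff_mulVec.continuous.comp hwc)
  set eStar : ℝ → Fin p → ℝ := fun t => pl.err (fun i => zs t (Sum.inl i)) (w t) with heStar
  have he1 : ContDiff ℝ 1 eStar :=
    (pl.Ce.contDiff_mulVec.comp ((hfst1.comp hzs1).sumElim (hQ.comp (hfst1.comp hzs1)))).add
      (pl.Qe.contDiff_mulVec.comp hw1)
  have heper : Function.Periodic eStar D := fun t => by
    simp only [heStar, hzsper t, hwper t]
  refine ⟨fun z₀ => ?_, fun z hz => ?_, eStar, heper.isBounded_of_continuous hD.ne' he1.continuous,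
    heper, he1, ⟨κ, hκ, fun z hz => ?_⟩, ?_⟩
  · obtain ⟨z, hz0, hz⟩ := hex z₀
    refine ⟨z, hz0, fun t _ => ?_⟩
    rw [hrhs]
    exact (hz t).hasDerivWithinAt
  · obtain ⟨R, hR⟩ := isBounded_iff_forall_norm_le.1
      (hzsper.isBounded_of_continuous hD.ne' hzsc)
    refine isBounded_iff_forall_norm_le.2 ⟨|C| * ‖z 0 - zs 0‖ + R, ?_⟩
    rintro _ ⟨t, ht, rfl⟩
    have h1 : ‖z t‖ ≤ ‖z t - zs t‖ + ‖zs t‖ := norm_le_norm_sub_add _ _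
    have h2 : C * Real.exp (-κ * t) ≤ |C| := by
      have hexp : Real.exp (-κ * t) ≤ 1 := by
        rw [Real.exp_le_one_iff]
        nlinarith [mem_Ici.1 ht]
      calc C * Real.exp (-κ * t) ≤ |C| * Real.exp (-κ * t) :=
            mul_le_mul_of_nonneg_right (le_abs_self C) (Real.exp_pos _).le
        _ ≤ |C| * 1 := mul_le_mul_of_nonneg_left hexp (abs_nonneg C)
        _ = |C| := mul_one _
    exact h1.trans (add_le_add ((hconv z hz t ht).trans
      (mul_le_mul_of_nonneg_right h2 (norm_nonneg _))) (hR _ (mem_range_self t)))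
  · obtain ⟨KC, hKC⟩ := pl.Ce.exists_lipschitzWith_mulVec
    have hL := hKC.comp (hfst.sumElim (hKQ.comp hfst))
    refine ⟨((KC * max 1 (KQ * 1) : NNReal) : ℝ) * (C * ‖z 0 - zs 0‖), fun t ht => ?_⟩
    have h := hL.norm_sub_le (z t) (zs t)
    have h' := h.trans (mul_le_mul_of_nonneg_left (hconv z hz t ht) (NNReal.coe_nonneg _))
    simp only [heStar, Plant.err, add_sub_add_right_eq_sub]
    refine h'.trans (le_of_eq ?_)
    ring
  · refine exists_isLUB_and_meanSquare_le hD ℓ he1 heper fun j k hk => ?_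
    exact pl.fourierCoeffOn_err_eq_zero hD hγ hN (u := fun t => K *ᵥ pl.calZ ℓ (zs t))
      (fun t => by rw [hrhs]; exact hzs t) hzsper he1.continuous j k hk
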